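/- **Setting.** Fix $\tau\in(0,1)$, integers $1\le k_1<K_1$ and $1\le k_2<K_2$, and a constant $c_0>0$. All limits are taken as $p_1,p_2,T\to\infty$ jointly, at arbitrary relative rates. The observed $p_1\times p_2$ matrices $X_t=(X_{ijt})$, $t=1,\dots,T$, follow the matrix quantile factor model $$X_{ijt}=r_{0i}'F_{0t}c_{0j}+\varepsilon_{ijt},\qquad P(\varepsilon_{ijt}\le 0\mid F_{01},\dots,F_{0T})=\tau\ \text{ a.s.},$$ with non-random loadings $r_{0i}\in\mathbb R^{k_1}$, $c_{0j}\in\mathbb R^{k_2}$ (which may depend on $p_1,p_2,T$) and possibly random factor matrices $F_{0t}\in\mathbb R^{k_1\times k_2}$. Let $R_0,C_0$ be the matrices with rows $r_{0i}'$, $c_{0j}'$. **Parameter spaces.** For $l_1,l_2\ge1$ and compact sets $\mathcal A\subset\mathbb R^{l_1}$, $\mathcal F\subset\mathbb R^{l_1\times l_2}$, $\mathcal B\subset\mathbb R^{l_2}$ not depending on $p_1,p_2,T$, let $\Theta^{l_1l_2}$ be the set of $\theta=(R,F_1,\dots,F_T,C)$ such that $r_i\in\mathcal A$, $F_t\in\mathcal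 F$, $c_j\in\mathcal B$ for all $i,t,j$ ($r_i'$, $c_j'$ being the rows of $R$, $C$), $R'R/p_1=\mathbb I_{l_1}$, $C'C/p_2=\mathbb I_{l_2}$, and $\frac1T\sum_tF_tF_t'$ and $\frac1T\sum_tF_t'F_t$ are diagonal with non-increasing diagonal entries. Fix such compact sets for $(l_1,l_2)=(k_1,k_2)$ and for $(l_1,l_2)=(K_1,K_2)$. **Assumptions.** 1. Almost surely, $\theta_0=(R_0,F_{01},\dots,F_{0T},C_0)\in\Theta^{k_1k_2}$, and its common components are attained in the overspecified space: there is $(R,F_1,\dots,F_T,C)\in\Theta^{K_1K_2}$ with $RF_tC'=R_0F_{0t}C_0'$ for all $t$. The $j$-th diagonal entry of $\frac1T\sum_tF_{0t}F_{0t}'$ converges in probability to a constant $\sigma_j>0$ for each $j\le k_1$, and that of $\frac1T\sum_tF_{0t}'F_{0t}$ to a constant $\sigma_j'>0$ for each $j\le k_2$. 2. Given $F_{01},\dots,F_{0T}$, each $\varepsilon_{ijt}$ has a conditional density $f_{ijt}$, and for every compact $D\subset\mathbb R$ there is a constant $\underline f>0$, depending only on $D$, with $f_{ijt}(u)\ge\underline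 f$ for all $u\in D$ and all $i,j,t,p_1,p_2,T$ (almost surely in the factors). 3. Given $F_{01},\dots,F_{0T}$, the errors $\varepsilon_{ijt}$ are independent across $i,j,t$. **Estimators.** Let $\rho_\tau(u)=(\tau-1\{u<0\})u$, let $L_{p_1p_2T}=\min\{\sqrt{p_1p_2},\sqrt{p_2T},\sqrt{p_1T}\}$, and let $\hat\theta^{K_1K_2}=(\hat R,\hat F_1,\dots,\hat F_T,\hat C)$ minimize $$\frac1{p_1p_2T}\sum_{i=1}^{p_1}\sum_{j=1}^{p_2}\sum_{t=1}^T\rho_\tau\big(X_{ijt}-r_i'F_tc_j\big)$$ over $\Theta^{K_1K_2}$. Denote the ordered eigenvalues by $$\frac1T\sum_t\hat F_t\hat F_t'=\mathrm{diag}(\hat\sigma_{T,1}^{K_1},\dots,\hat\sigma_{T,K_1}^{K_1}),\qquad \frac1T\sum_t\hat F_t'\hat F_t=\mathrm{diag}(\hat\sigma_{T,1}^{K_2},\dots,\hat\sigma_{T,K_2}^{K_2}),$$ and let, for $m=1,2$ and with any choice in case of ties, $$\hat k_m^{ER}\in\operatorname*{arg\,max}_{1\le k\le K_m-1}\ \frac{\hat\sigma_{T,k}^{K_m}}{\hat\sigma_{T,k+1}^{K_m}+c_0L_{p_1p_2T}^{-2}}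 .$$ **Theorem 4.3.** Under these assumptions, $$P\big(\hat k_1^{ER}=k_1,\ \hat k_2^{ER}=k_2\big)\to1\qquad\text{as }p_1,p_2,T\to\infty .$$ -/

import Mathlib

open MeasureTheory ProbabilityTheory Filter Topology

noncomputable section

namespace MatrixQuantileFactor

/-- The product (entrywise) σ-algebra on matrices. -/
instance matrixMeasurableSpace {m n : ℕ} : MeasurableSpace (Matrix (Fin m) (Fin n) ℝ) :=
  inferInstanceAs (MeasurableSpace (Fin m → Fin n → ℝ))

/-- A parameter `θ = (R, F_1, …, F_T, C)` with `l1` row factors and `l2` column factors.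
Row `i` of `R` is `r_i'`, row `j` of `C` is `c_j'`, and `F t` is the `l1 × l2` factor matrix. -/
structure Param (p1 p2 T l1 l2 : ℕ) where
  R : Matrix (Fin p1) (Fin l1) ℝ
  F : Fin T → Matrix (Fin l1) (Fin l2) ℝ
  C : Matrix (Fin p2) (Fin l2) ℝ

/-- The matrix of common components `R F_t C'`; its `(i, j)` entry is `r_i' F_t c_j`. -/
def Param.common {p1 p2 T l1 l2 : ℕ} (θ : Param p1 p2 T l1 l2) (t : Fin T) :
    Matrix (Fin p1) (Fin p2) ℝ :=
  θ.R * θ.F t * θ.C.transpose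

/-- `T⁻¹ ∑ₜ F_t F_t'`. -/
def rowGram {T l1 l2 : ℕ} (F : Fin T → Matrix (Fin l1) (Fin l2) ℝ) :
    Matrix (Fin l1) (Fin l1) ℝ :=
  (T : ℝ)⁻¹ • ∑ t, F t * (F t).transpose

/-- `T⁻¹ ∑ₜ F_t' F_t`. -/
def colGram {T l1 l2 : ℕ} (F : Fin T → Matrix (Fin l1) (Fin l2) ℝ) :
    Matrix (Fin l2) (Fin l2) ℝ :=
  (T : ℝ)⁻¹ • ∑ t, (F t).transpose * F t

/-- A diagonal matrix whose diagonal entries do not increase. -/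
def IsDescendingDiag {l : ℕ} (M : Matrix (Fin l) (Fin l) ℝ) : Prop :=
  M.IsDiag ∧ Antitone M.diag

/-- The parameter space: `r_i`, `F_t`, `c_j` range over given sets, `R'R/p1` and `C'C/p2` are
identity matrices, and `T⁻¹ ∑ₜ F_t F_t'`, `T⁻¹ ∑ₜ F_t' F_t` are diagonal with non-increasing
diagonal entries (which are therefore the ordered eigenvalues of these matrices). -/
def paramSpace {l1 l2 : ℕ} (p1 p2 T : ℕ) (A : Set (Fin l1 → ℝ))
    (S : Set (Matrix (Fin l1) (Fin l2) ℝ)) (B : Set (Fin l2 → ℝ)) :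
    Set (Param p1 p2 T l1 l2) :=
  {θ | (∀ i, θ.R i ∈ A) ∧ (∀ t, θ.F t ∈ S) ∧ (∀ j, θ.C j ∈ B) ∧
    (p1 : ℝ)⁻¹ • (θ.R.transpose * θ.R) = 1 ∧
    (p2 : ℝ)⁻¹ • (θ.C.transpose * θ.C) = 1 ∧
    IsDescendingDiag (rowGram θ.F) ∧ IsDescendingDiag (colGram θ.F)}

/-- The check function `ρ_τ(u) = (τ - 1{u < 0}) u`. -/
def checkLoss (τ u : ℝ) : ℝ :=
  (τ - if u < 0 then 1 else 0) * u

/-- The empirical check loss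
`(p1 p2 T)⁻¹ ∑ᵢ ∑ⱼ ∑ₜ ρ_τ(X_{ijt} - r_i' F_t c_j)`. -/
def empLoss {p1 p2 T l1 l2 : ℕ} (τ : ℝ) (X : Fin T → Matrix (Fin p1) (Fin p2) ℝ)
    (θ : Param p1 p2 T l1 l2) : ℝ :=
  ((p1 : ℝ) * p2 * T)⁻¹ * ∑ i, ∑ j, ∑ t, checkLoss τ (X t i j - θ.common t i j)

/-- `θ` minimizes the empirical check loss over the parameter set `Θ`. -/
def IsQuantileFit {p1 p2 T l1 l2 : ℕ} (τ : ℝ) (X : Fin T → Matrix (Fin p1) (Fin p2) ℝ)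
    (Θ : Set (Param p1 p2 T l1 l2)) (θ : Param p1 p2 T l1 l2) : Prop :=
  θ ∈ Θ ∧ IsMinOn (empLoss τ X) Θ θ

/-- `L = min {√(p1 p2), √(p2 T), √(p1 T)}`. -/
def rateL (p1 p2 T : ℕ) : ℝ :=
  min (√((p1 : ℝ) * p2)) (min (√((p2 : ℝ) * T)) (√((p1 : ℝ) * T)))

/-- The `k`-th diagonal entry, counted from `k = 1` (and `0` outside `1 ≤ k ≤ l`). -/
def diagEntry {l : ℕ} (M : Matrix (Fin l) (Fin l) ℝ) (k : ℕ) : ℝ :=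
  if h : 1 ≤ k ∧ k ≤ l then M ⟨k - 1, by omega⟩ ⟨k - 1, by omega⟩ else 0

/-- The eigenvalue ratio `σ_k / (σ_{k+1} + c0 L⁻²)`, where `σ_1 ≥ σ_2 ≥ …` are the diagonal
entries of `M`. -/
def eigRatio {l : ℕ} (M : Matrix (Fin l) (Fin l) ℝ) (c0 L : ℝ) (k : ℕ) : ℝ :=
  diagEntry M k / (diagEntry M (k + 1) + c0 * (L ^ 2)⁻¹)

/-- `k` maximizes the eigenvalue ratio over `1 ≤ k ≤ l - 1`. -/
def IsERChoice {l : ℕ} (M : Matrix (Fin l) (Fin l) ℝ) (c0 L : ℝ) (k : ℕ) : Prop :=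
  k ∈ Finset.Icc 1 (l - 1) ∧ ∀ m ∈ Finset.Icc 1 (l - 1), eigRatio M c0 L m ≤ eigRatio M c0 L k

/-- The true parameter, when the loadings are `R0`, `C0` and the factors are `F0`. -/
def truth {p1 p2 T k1 k2 : ℕ} (R0 : Matrix (Fin p1) (Fin k1) ℝ)
    (C0 : Matrix (Fin p2) (Fin k2) ℝ) (F0 : Fin T → Matrix (Fin k1) (Fin k2) ℝ) :
    Param p1 p2 T k1 k2 :=
  ⟨R0, F0, C0⟩

/-- The idiosyncratic errors `ε_{ijt} = X_{ijt} - r_{0i}' F_{0t} c_{0j}`, as one array. -/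
def errors {p1 p2 T k1 k2 : ℕ} (X : Fin T → Matrix (Fin p1) (Fin p2) ℝ)
    (θ0 : Param p1 p2 T k1 k2) : Fin p1 × Fin p2 × Fin T → ℝ :=
  fun a => X a.2.2 a.1 a.2.1 - θ0.common a.2.2 a.1 a.2.1

/-- The conditions on the regular conditional law of the error array given the factors
`F_{01}, …, F_{0T}`. For almost every value `f` of the factors: the errors are independent over
`(i, j, t)`, the error `(i, j, t)` has the Lebesgue density `g f (i, j, t)`, and its
`τ`-quantile is zero, that is, `P(ε_{ijt} ≤ 0 | F_0) = τ`. -/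
def ErrorLaw {p1 p2 T k1 k2 : ℕ} {Ω : Type*} [MeasurableSpace Ω] (μ : Measure Ω)
    [IsFiniteMeasure μ] (τ : ℝ)
    (ε : Ω → Fin p1 × Fin p2 × Fin T → ℝ) (F0 : Ω → Fin T → Matrix (Fin k1) (Fin k2) ℝ)
    (g : (Fin T → Matrix (Fin k1) (Fin k2) ℝ) → Fin p1 × Fin p2 × Fin T → ℝ → ℝ) : Prop :=
  ∀ᵐ f ∂(μ.map F0),
    iIndepFun (fun (a : Fin p1 × Fin p2 × Fin T) (e : Fin p1 × Fin p2 × Fin T → ℝ) => e a)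
      (condDistrib ε F0 μ f) ∧
    ∀ a, Measurable (g f a) ∧
      (condDistrib ε F0 μ f).map (fun e => e a)
        = volume.withDensity (fun u => ENNReal.ofReal (g f a u)) ∧
      condDistrib ε F0 μ f {e | e a ≤ 0} = ENNReal.ofReal τ

end MatrixQuantileFactor

end

/-! Write L for `rateL` and N for p1 p2 T. Everything rests on one crude rate: with probability
tending to one, `meanSq` between the fitted and the true common components is below L^(-3/2), which
is `fitRate`.

Given this rate, the Weyl-type inequality `diagEntry_rowGram_le` keeps the k1-th fitted eigenvalue
above a positive constant and puts the next one below 2 L^(-3/2), since the true parameter has only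
k1 row factors. Ratios before k1 are then bounded, the ratio at k1 is at least of order L^(3/2), and
later ones are at most of order L^(1/2) because of the term c0 L^(-2) in the denominator
(`IsERChoice.eq_of_gap`). Any rate o(L^(-1)) would do, which leaves room for the logarithm lost in a
union bound over a grid.

For the rate, the fit has no larger loss than the truth, whose common components are attained in the
overspecified space. Given the factors, the expected excess loss of a shift d is at least a multiple
of ∑ d_a² (`integral_excessLoss_ge`). Each summand is bounded by |d_a|, so ∑ d_a² is also the
sub-Gaussian parameter, and a fixed shift of mean square r has small excess loss with probability at
most exp(-const N r) (`measureReal_sum_excessLoss_le`). A grid of parameters has log-cardinality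
O((p1 + p2 + T) log L) = O(N L^(-2) log L), negligible against N L^(-3/2)
(`eventually_pow_mul_exp_le`). Column factors are the row factors of the transposed model. -/

namespace MatrixQuantileFactor

/-! ### Perturbation of the factor eigenvalues -/

section LinearAlgebra

open Matrix

/-- The mean squared difference of two arrays of common components. -/
noncomputable def meanSq {p1 p2 T l1 l2 m1 m2 : ℕ} (θ : Param p1 p2 T l1 l2)
    (θ' : Param p1 p2 T m1 m2) : ℝ :=
  ((p1 : ℝ) * p2 * T)⁻¹ *
    ∑ t, ∑ i, ∑ j, (θ.common t i j - θ'.common t i j) ^ 2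

/-- The parameter of the transposed model, with rows and columns exchanged. -/
def Param.transpose {p1 p2 T l1 l2 : ℕ} (θ : Param p1 p2 T l1 l2) : Param p2 p1 T l2 l1 :=
  ⟨θ.C, fun t => (θ.F t).transpose, θ.R⟩

theorem Param.transpose_common {p1 p2 T l1 l2 : ℕ} (θ : Param p1 p2 T l1 l2) (t : Fin T) :
    θ.transpose.common t = (θ.common t).transpose := by
  simp [Param.transpose, Param.common, Matrix.transpose_mul, Matrix.mul_assoc]

theorem Param.rowGram_transpose {p1 p2 T l1 l2 : ℕ} (θ : Param p1 p2 T l1 l2) :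
    rowGram θ.transpose.F = colGram θ.F := by
  simp [Param.transpose, rowGram, colGram]

theorem meanSq_transpose {p1 p2 T l1 l2 m1 m2 : ℕ} (θ : Param p1 p2 T l1 l2)
    (θ' : Param p1 p2 T m1 m2) : meanSq θ.transpose θ'.transpose = meanSq θ θ' := by
  unfold meanSq
  rw [mul_comm (p2 : ℝ) p1]
  congr 1
  refine Finset.sum_congr rfl fun t _ => ?_
  rw [Finset.sum_comm]
  simp [Param.transpose_common]

theorem transpose_mul_self_of_normalized {p l : ℕ} (hp : 0 < p) {R : Matrix (Fin p) (Fin l) ℝ}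
    (h : (p : ℝ)⁻¹ • (Rᵀ * R) = 1) : Rᵀ * R = (p : ℝ) • 1 := by
  rw [← h, smul_smul, mul_inv_cancel₀ (by positivity), one_smul]

theorem dotProduct_mulVec_self {p l : ℕ} {R : Matrix (Fin p) (Fin l) ℝ}
    (h : Rᵀ * R = (p : ℝ) • 1) (y : Fin l → ℝ) :
    (R *ᵥ y) ⬝ᵥ (R *ᵥ y) = p * (y ⬝ᵥ y) := by
  have : (R *ᵥ y) ⬝ᵥ (R *ᵥ y) = y ⬝ᵥ ((Rᵀ * R) *ᵥ y) := by
    rw [← Matrix.mulVec_mulVec, Matrix.dotProduct_mulVec y, Matrix.vecMul_transpose]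
  rw [this, h, Matrix.smul_mulVec, Matrix.one_mulVec, dotProduct_smul, smul_eq_mul]

/-- Bessel's inequality for a matrix with orthogonal columns of squared length `p`. -/
theorem dotProduct_vecMul_self_le {p l : ℕ} (hp : 0 < p) {R : Matrix (Fin p) (Fin l) ℝ}
    (h : Rᵀ * R = (p : ℝ) • 1) (x : Fin p → ℝ) :
    (x ᵥ* R) ⬝ᵥ (x ᵥ* R) ≤ p * (x ⬝ᵥ x) := by
  set z := x ᵥ* R with hz
  have h1 : (R *ᵥ z) ⬝ᵥ (R *ᵥ z) = p * (z ⬝ᵥ z) := dotProduct_mulVec_self h z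
  have h2 : x ⬝ᵥ (R *ᵥ z) = z ⬝ᵥ z := by rw [Matrix.dotProduct_mulVec]
  -- Expanding this square gives p²|x|² - p|z|².
  have h3 : 0 ≤ ((p : ℝ) • x - R *ᵥ z) ⬝ᵥ ((p : ℝ) • x - R *ᵥ z) :=
    Finset.sum_nonneg fun i _ => mul_self_nonneg _
  rw [sub_dotProduct, dotProduct_sub, dotProduct_sub, h1, smul_dotProduct, smul_dotProduct,
    dotProduct_smul, dotProduct_smul, dotProduct_comm (R *ᵥ z) x, h2] at h3
  simp only [smul_eq_mul] at h3
  have hp' : (0 : ℝ) < p := by exact_mod_cast hp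
  nlinarith

/-- The energy of the common components in the direction `x`. -/
theorem sum_sq_vecMul_common {p1 p2 T l1 l2 : ℕ} (hT : 0 < T) (θ : Param p1 p2 T l1 l2)
    (hC : θ.Cᵀ * θ.C = (p2 : ℝ) • 1) (hD : (rowGram θ.F).IsDiag) (x : Fin p1 → ℝ) :
    ∑ t, (x ᵥ* θ.common t) ⬝ᵥ (x ᵥ* θ.common t)
      = p2 * T * ∑ a, rowGram θ.F a a * (x ᵥ* θ.R) a ^ 2 := by
  set z := x ᵥ* θ.R with hz
  have h1 : ∀ t, (x ᵥ* θ.common t) ⬝ᵥ (x ᵥ* θ.common t)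
      = p2 * (z ⬝ᵥ ((θ.F t * (θ.F t)ᵀ) *ᵥ z)) := by
    intro t
    have : x ᵥ* θ.common t = θ.C *ᵥ (z ᵥ* θ.F t) := by
      rw [Param.common, ← Matrix.vecMul_vecMul, ← Matrix.vecMul_vecMul, Matrix.vecMul_transpose]
    rw [this, dotProduct_mulVec_self hC, Matrix.dotProduct_mulVec, ← Matrix.vecMul_vecMul,
      Matrix.vecMul_transpose, dotProduct_comm (θ.F t *ᵥ _), Matrix.dotProduct_mulVec]
  have h2 : ∑ t, z ⬝ᵥ ((θ.F t * (θ.F t)ᵀ) *ᵥ z) = T * (z ⬝ᵥ (rowGram θ.F *ᵥ z)) := by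
    have hT' : (T : ℝ) ≠ 0 := by positivity
    rw [rowGram, Matrix.smul_mulVec, dotProduct_smul, smul_eq_mul, mul_inv_cancel_left₀ hT',
      Matrix.sum_mulVec, dotProduct_sum]
  have h3 : z ⬝ᵥ (rowGram θ.F *ᵥ z) = ∑ a, rowGram θ.F a a * z a ^ 2 := by
    refine Finset.sum_congr rfl fun a _ => ?_
    have : (rowGram θ.F *ᵥ z) a = rowGram θ.F a a * z a := by
      rw [Matrix.mulVec, dotProduct, Finset.sum_eq_single a]
      · intro b _ hb
        rw [hD hb.symm, zero_mul]
      · simp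
    rw [this]; ring
  simp_rw [h1]
  rw [← Finset.mul_sum, h2, h3, mul_assoc]

theorem rowGram_diag_nonneg {T l1 l2 : ℕ} (F : Fin T → Matrix (Fin l1) (Fin l2) ℝ) (a : Fin l1) :
    0 ≤ rowGram F a a := by
  simp only [rowGram, Matrix.smul_apply, Matrix.sum_apply, Matrix.mul_apply,
    Matrix.transpose_apply, smul_eq_mul]
  exact mul_nonneg (by positivity) (Finset.sum_nonneg fun t _ => Finset.sum_nonneg fun b _ =>
    mul_self_nonneg _)

/-- Dimension count: k + 1 free coordinates against k equations. The square matrix `Q` stacks the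
equations, padded by zero rows if `m` is small, then a zero row at position k that makes it
singular, then unit rows that kill the later coordinates. -/
theorem exists_ne_zero_mulVec_eq_zero {l m : ℕ} (M : Matrix (Fin m) (Fin l) ℝ) (k : Fin l) :
    ∃ a : Fin l → ℝ, a ≠ 0 ∧ (∀ i, k < i → a i = 0) ∧
      ∀ i : Fin m, (i : ℕ) < k → (M *ᵥ a) i = 0 := by
  classical
  let Q : Matrix (Fin l) (Fin l) ℝ := fun i b =>
    if i < k then (if h : (i : ℕ) < m then M ⟨i, h⟩ b else 0) else if i = k then 0 else
      if i = b then 1 else 0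
  have hdet : Q.det = 0 := Matrix.det_eq_zero_of_row_eq_zero k fun b => by simp [Q]
  obtain ⟨a, ha, hQ⟩ := Matrix.exists_mulVec_eq_zero_iff.mpr hdet
  refine ⟨a, ha, fun i hi => ?_, fun i hi => ?_⟩
  · have := congrFun hQ i
    simpa [Q, Matrix.mulVec, dotProduct, not_lt_of_gt hi, hi.ne'] using this
  · have := congrFun hQ ⟨i, hi.trans k.2⟩
    have hlt : (⟨i, hi.trans k.2⟩ : Fin l) < k := hi
    simpa [Q, Matrix.mulVec, dotProduct, hlt] using this

/-- Cauchy–Schwarz in every column of every difference matrix. -/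
theorem sum_sq_vecMul_sub_le {p1 p2 T l1 l2 m1 m2 : ℕ} (hp1 : 0 < p1) (hp2 : 0 < p2) (hT : 0 < T)
    (θ : Param p1 p2 T l1 l2) (θ' : Param p1 p2 T m1 m2) (x : Fin p1 → ℝ) :
    ∑ t, (x ᵥ* (θ.common t - θ'.common t)) ⬝ᵥ (x ᵥ* (θ.common t - θ'.common t))
      ≤ (x ⬝ᵥ x) * (p1 * p2 * T * meanSq θ θ') := by
  have hN : ((p1 : ℝ) * p2 * T) ≠ 0 := by positivity
  rw [meanSq, mul_inv_cancel_left₀ hN, Finset.mul_sum]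
  refine Finset.sum_le_sum fun t _ => ?_
  rw [Finset.sum_comm, Finset.mul_sum]
  refine Finset.sum_le_sum fun j _ => ?_
  have := Finset.sum_mul_sq_le_sq_mul_sq Finset.univ x
    (fun i => θ.common t i j - θ'.common t i j)
  have hx : x ⬝ᵥ x = ∑ i, x i ^ 2 := Finset.sum_congr rfl fun i _ => by ring
  rw [hx]
  simpa [Matrix.vecMul, dotProduct, ← sq] using this

theorem dotProduct_self_add_le {n : Type*} [Fintype n] (u v : n → ℝ) :
    u ⬝ᵥ u ≤ 2 * (v ⬝ᵥ v) + 2 * ((u - v) ⬝ᵥ (u - v)) := by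
  simp only [dotProduct, Finset.mul_sum, ← Finset.sum_add_distrib]
  refine Finset.sum_le_sum fun i _ => ?_
  simp only [Pi.sub_apply]
  nlinarith [sq_nonneg (u i - 2 * v i)]

/-- A Weyl-type inequality: the ordered eigenvalues of the factor second moments are stable under
mean squared perturbations of the common components. -/
theorem diagEntry_rowGram_le {p1 p2 T l1 l2 m1 m2 : ℕ} (hp1 : 0 < p1) (hp2 : 0 < p2) (hT : 0 < T)
    (θ : Param p1 p2 T l1 l2) (θ' : Param p1 p2 T m1 m2)
    (hR : (p1 : ℝ)⁻¹ • (θ.Rᵀ * θ.R) = 1) (hC : (p2 : ℝ)⁻¹ • (θ.Cᵀ * θ.C) = 1)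
    (hD : IsDescendingDiag (rowGram θ.F))
    (hR' : (p1 : ℝ)⁻¹ • (θ'.Rᵀ * θ'.R) = 1) (hC' : (p2 : ℝ)⁻¹ • (θ'.Cᵀ * θ'.C) = 1)
    (hD' : IsDescendingDiag (rowGram θ'.F)) {k : ℕ} (hk : 1 ≤ k) (hkl : k ≤ l1) :
    diagEntry (rowGram θ.F) k ≤ 2 * diagEntry (rowGram θ'.F) k + 2 * meanSq θ θ' := by
  replace hR := transpose_mul_self_of_normalized hp1 hR
  replace hC := transpose_mul_self_of_normalized hp2 hC
  replace hR' := transpose_mul_self_of_normalized hp1 hR'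
  replace hC' := transpose_mul_self_of_normalized hp2 hC'
  set κ : Fin l1 := ⟨k - 1, by omega⟩ with hκ
  -- The Courant–Fischer test direction: `x = R a` lies in the span of the first k columns of `θ.R`
  -- and is orthogonal to the first k - 1 columns of `θ'.R`.
  obtain ⟨a, ha, ha0, haM⟩ := exists_ne_zero_mulVec_eq_zero (θ'.Rᵀ * θ.R) κ
  set x := θ.R *ᵥ a with hx
  have hxR : x ᵥ* θ.R = (p1 : ℝ) • a := by
    rw [← Matrix.mulVec_transpose, hx, Matrix.mulVec_mulVec, hR, Matrix.smul_mulVec,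
      Matrix.one_mulVec]
  have hxx : x ⬝ᵥ x = p1 * (a ⬝ᵥ a) := dotProduct_mulVec_self hR a
  have haa : 0 < a ⬝ᵥ a := by
    have h0 : 0 ≤ a ⬝ᵥ a := Finset.sum_nonneg fun i _ => mul_self_nonneg _
    exact lt_of_le_of_ne h0 fun h => ha (dotProduct_self_eq_zero.mp h.symm)
  set z := x ᵥ* θ'.R with hz
  have hzlow : ∀ i : Fin m1, (i : ℕ) < κ → z i = 0 := fun i hi => by
    have := haM i hi
    rwa [← Matrix.mulVec_mulVec, Matrix.mulVec_transpose] at this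
  have hlow : diagEntry (rowGram θ.F) k * (p1 ^ 2 * (a ⬝ᵥ a))
      ≤ ∑ i, rowGram θ.F i i * (x ᵥ* θ.R) i ^ 2 := by
    rw [diagEntry, dif_pos ⟨hk, hkl⟩, dotProduct, Finset.mul_sum, Finset.mul_sum, hxR]
    refine Finset.sum_le_sum fun i _ => ?_
    rcases lt_or_ge κ i with h | h
    · simp [ha0 i h]
    · have : rowGram θ.F κ κ ≤ rowGram θ.F i i := hD.2 h
      simp only [Pi.smul_apply, smul_eq_mul]
      nlinarith [mul_le_mul_of_nonneg_right this (sq_nonneg ((p1 : ℝ) * a i))]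
  -- If `θ'` has fewer than k row factors, `z` vanishes entirely, in agreement with the default
  -- value 0 of `diagEntry`.
  have hup : ∑ i, rowGram θ'.F i i * z i ^ 2 ≤ diagEntry (rowGram θ'.F) k * (z ⬝ᵥ z) := by
    rw [dotProduct, Finset.mul_sum]
    refine Finset.sum_le_sum fun i _ => ?_
    rcases lt_or_ge (i : ℕ) κ with h | h
    · simp [hzlow i h]
    · have hkm : k ≤ m1 := by
        have := i.2
        simp only [hκ] at h
        omega
      rw [diagEntry, dif_pos ⟨hk, hkm⟩, ← sq]
      have hle : (⟨k - 1, by omega⟩ : Fin m1) ≤ i := h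
      exact mul_le_mul_of_nonneg_right (hD'.2 hle) (sq_nonneg _)
  have hd' : 0 ≤ diagEntry (rowGram θ'.F) k := by
    unfold diagEntry
    split_ifs
    · exact rowGram_diag_nonneg _ _
    · exact le_rfl
  have hbes : z ⬝ᵥ z ≤ p1 * (x ⬝ᵥ x) := dotProduct_vecMul_self_le hp1 hR' x
  have hE := sum_sq_vecMul_common hT θ hC hD.1 x
  have hE' := sum_sq_vecMul_common hT θ' hC' hD'.1 x
  have hsub := sum_sq_vecMul_sub_le hp1 hp2 hT θ θ' x
  have htri : ∑ t, (x ᵥ* θ.common t) ⬝ᵥ (x ᵥ* θ.common t)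
      ≤ 2 * ∑ t, (x ᵥ* θ'.common t) ⬝ᵥ (x ᵥ* θ'.common t) + 2 * ∑ t,
        (x ᵥ* (θ.common t - θ'.common t)) ⬝ᵥ (x ᵥ* (θ.common t - θ'.common t)) := by
    rw [Finset.mul_sum, Finset.mul_sum, ← Finset.sum_add_distrib]
    refine Finset.sum_le_sum fun t _ => ?_
    rw [Matrix.vecMul_sub]
    exact dotProduct_self_add_le _ _
  rw [hE, hE'] at htri
  have hq : (0 : ℝ) < p2 * T := by positivity
  have hs : (0 : ℝ) < p1 ^ 2 * (a ⬝ᵥ a) := by positivity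
  have hup2 : ∑ i, rowGram θ'.F i i * z i ^ 2
      ≤ diagEntry (rowGram θ'.F) k * (p1 ^ 2 * (a ⬝ᵥ a)) := by
    refine hup.trans (mul_le_mul_of_nonneg_left ?_ hd')
    rw [hxx] at hbes
    linarith
  have hfin : p2 * T * (diagEntry (rowGram θ.F) k * (p1 ^ 2 * (a ⬝ᵥ a)))
      ≤ p2 * T * ((2 * diagEntry (rowGram θ'.F) k + 2 * meanSq θ θ') * (p1 ^ 2 * (a ⬝ᵥ a))) := by
    have e1 := mul_le_mul_of_nonneg_left hlow hq.le
    have e2 := mul_le_mul_of_nonneg_left hup2 hq.le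
    rw [hxx] at hsub
    linarith
  exact le_of_mul_le_mul_right (le_of_mul_le_mul_left hfin hq) hs

end LinearAlgebra

/-! ### Excess check loss: quadratic growth and concentration -/

/-- The change of the check loss at `u` when the location moves from `0` to `d`. -/
noncomputable def excessLoss (τ d u : ℝ) : ℝ := checkLoss τ (u - d) - checkLoss τ u

theorem measurable_checkLoss (τ : ℝ) : Measurable (checkLoss τ) := by
  unfold checkLoss
  exact (measurable_const.sub
    (Measurable.ite measurableSet_Iio measurable_const measurable_const)).mul measurable_id

theorem measurable_excessLoss (τ d : ℝ) : Measurable (excessLoss τ d) :=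
  ((measurable_checkLoss τ).comp (measurable_id.sub_const d)).sub (measurable_checkLoss τ)

theorem abs_checkLoss_sub_le {τ : ℝ} (hτ : τ ∈ Set.Ioo (0 : ℝ) 1) (u v : ℝ) :
    |checkLoss τ u - checkLoss τ v| ≤ |u - v| := by
  obtain ⟨h0, h1⟩ := hτ
  unfold checkLoss
  rcases le_total u v with h | h
  · rw [abs_of_nonpos (sub_nonpos.2 h), abs_le]
    split_ifs <;> constructor <;> nlinarith
  · rw [abs_of_nonneg (sub_nonneg.2 h), abs_le]
    split_ifs <;> constructor <;> nlinarith

theorem abs_excessLoss_le {τ : ℝ} (hτ : τ ∈ Set.Ioo (0 : ℝ) 1) (d u : ℝ) :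
    |excessLoss τ d u| ≤ |d| := by
  have := abs_checkLoss_sub_le hτ (u - d) u
  rwa [sub_sub_cancel_left, abs_neg] at this

/-- A pointwise form of Knight's identity: the linear part has mean zero at the quantile, and the
nonnegative remainder is kept only for 0 < u ≤ d/2, where it equals d - u ≥ d/2. -/
theorem excessLoss_ge_of_nonneg (τ : ℝ) {d : ℝ} (hd : 0 ≤ d) (u : ℝ) :
    -d * τ + d * (Set.Iic (0 : ℝ)).indicator 1 u
      + d / 2 * (Set.Ioc 0 (d / 2)).indicator 1 u ≤ excessLoss τ d u := by
  simp only [excessLoss, checkLoss, Set.indicator_apply, Set.mem_Iic, Set.mem_Ioc, Pi.one_apply]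
  split_ifs <;> first | (exfalso; grind) | nlinarith

theorem excessLoss_ge_of_nonpos (τ : ℝ) {d : ℝ} (hd : d ≤ 0) (u : ℝ) :
    -d * τ + d * (Set.Iic (0 : ℝ)).indicator 1 u
      + -d / 2 * (Set.Ioc (d / 2) 0).indicator 1 u ≤ excessLoss τ d u := by
  simp only [excessLoss, checkLoss, Set.indicator_apply, Set.mem_Iic, Set.mem_Ioc, Pi.one_apply]
  split_ifs <;> first | (exfalso; grind) | nlinarith

theorem measureReal_Ioc_ge_of_density {ν : Measure ℝ} [IsProbabilityMeasure ν] {g : ℝ → ℝ}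
    (hν : ν = volume.withDensity (fun u => ENNReal.ofReal (g u))) {b x y : ℝ} (hb : 0 < b)
    (hg : ∀ u ∈ Set.Ioc x y, b ≤ g u) :
    b * (y - x) ≤ ν.real (Set.Ioc x y) := by
  have h1 : ENNReal.ofReal b * ENNReal.ofReal (y - x) ≤ ν (Set.Ioc x y) := by
    rw [hν, withDensity_apply _ measurableSet_Ioc, ← Real.volume_Ioc, ← setLIntegral_const]
    exact setLIntegral_mono' measurableSet_Ioc fun u hu => ENNReal.ofReal_le_ofReal (hg u hu)
  rw [← ENNReal.ofReal_mul hb.le] at h1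
  exact (ENNReal.ofReal_le_iff_le_toReal (measure_ne_top _ _)).1 h1

/-- The expected check loss grows quadratically around the quantile. -/
theorem integral_excessLoss_ge {τ : ℝ} (hτ : τ ∈ Set.Ioo (0 : ℝ) 1) {ν : Measure ℝ}
    [IsProbabilityMeasure ν] {g : ℝ → ℝ}
    (hν : ν = volume.withDensity (fun u => ENNReal.ofReal (g u)))
    (hq : ν (Set.Iic 0) = ENNReal.ofReal τ) {b W d : ℝ} (hb : 0 < b)
    (hg : ∀ u ∈ Set.Icc (-W) W, b ≤ g u) (hd : |d| ≤ W) :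
    b / 4 * d ^ 2 ≤ ∫ u, excessLoss τ d u ∂ν := by
  have hint : Integrable (excessLoss τ d) ν :=
    Integrable.of_bound (measurable_excessLoss τ d).aestronglyMeasurable |d|
      (ae_of_all _ fun u => abs_excessLoss_le hτ d u)
  have hi : ∀ s : Set ℝ, MeasurableSet s → Integrable (s.indicator (1 : ℝ → ℝ)) ν := fun s hs =>
    (integrable_const (1 : ℝ)).indicator hs
  have hqr : ν.real (Set.Iic 0) = τ := by
    rw [Measure.real, hq, ENNReal.toReal_ofReal hτ.1.le]
  -- The first two terms of the minorant cancel on integration because ν(-∞, 0] = τ. What remains is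
  -- |d|/2 times the mass of an interval of length |d|/2, hence at least b d²/4.
  have key : ∀ (e : ℝ) (s : Set ℝ), MeasurableSet s →
      (∀ u, -d * τ + d * (Set.Iic (0 : ℝ)).indicator 1 u + e * s.indicator 1 u
        ≤ excessLoss τ d u) → e * ν.real s ≤ ∫ u, excessLoss τ d u ∂ν := by
    intro e s hs h
    have h1 := (hi _ (measurableSet_Iic (a := (0 : ℝ)))).const_mul d
    have h2 := (hi s hs).const_mul e
    have h12 : Integrable (fun u => -d * τ + d * (Set.Iic (0 : ℝ)).indicator 1 u) ν :=
      (integrable_const (-d * τ)).add h1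
    have h3 := integral_mono (h12.add h2) hint h
    have h4 : ∫ u, (-d * τ + d * (Set.Iic (0 : ℝ)).indicator 1 u + e * s.indicator 1 u) ∂ν
        = e * ν.real s := by
      rw [integral_add h12 h2, integral_add (integrable_const _) h1,
        integral_const_mul d, integral_const_mul e, integral_indicator_one measurableSet_Iic,
        integral_indicator_one hs, hqr]
      simp
    rw [← h4]
    exact h3
  rw [abs_le] at hd
  rcases le_total 0 d with h | h
  · have h1 := key (d / 2) _ measurableSet_Ioc (excessLoss_ge_of_nonneg τ h)
    have h2 := measureReal_Ioc_ge_of_density hν hb (x := 0) (y := d / 2)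
      fun u hu => hg u ⟨by linarith [hu.1], by linarith [hu.2]⟩
    nlinarith
  · have h1 := key (-d / 2) _ measurableSet_Ioc (excessLoss_ge_of_nonpos τ h)
    have h2 := measureReal_Ioc_ge_of_density hν hb (x := d / 2) (y := 0)
      fun u hu => hg u ⟨by linarith [hu.1], by linarith [hu.2]⟩
    nlinarith

/-- Hoeffding's inequality for the total excess loss at a fixed shift of the locations. -/
theorem measureReal_sum_excessLoss_le {ι : Type*} [Fintype ι] {τ : ℝ}
    (hτ : τ ∈ Set.Ioo (0 : ℝ) 1) {Q : Measure (ι → ℝ)} [IsProbabilityMeasure Q]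
    {g : ι → ℝ → ℝ} (hind : iIndepFun (fun (a : ι) (e : ι → ℝ) => e a) Q)
    (hdens : ∀ a, Q.map (fun e => e a) = volume.withDensity (fun u => ENNReal.ofReal (g a u)))
    (hq : ∀ a, Q {e | e a ≤ 0} = ENNReal.ofReal τ) {b W : ℝ} (hb : 0 < b)
    (hg : ∀ a, ∀ u ∈ Set.Icc (-W) W, b ≤ g a u) (d : ι → ℝ) (hd : ∀ a, |d a| ≤ W) :
    Q.real {e | ∑ a, excessLoss τ (d a) (e a) ≤ b / 8 * ∑ a, d a ^ 2}
      ≤ Real.exp (-(b ^ 2 / 128 * ∑ a, d a ^ 2)) := by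
  have hmeas : ∀ a, Measurable fun e : ι → ℝ => e a := fun a => measurable_pi_apply a
  set Z : ι → (ι → ℝ) → ℝ := fun a e => excessLoss τ (d a) (e a) with hZ
  have hZm : ∀ a, Measurable (Z a) := fun a => (measurable_excessLoss τ (d a)).comp (hmeas a)
  have hmean : ∀ a, b / 4 * d a ^ 2 ≤ ∫ e, Z a e ∂Q := by
    intro a
    have hp : IsProbabilityMeasure (Q.map fun e => e a) :=
      Measure.isProbabilityMeasure_map (hmeas a).aemeasurable
    have h := integral_excessLoss_ge hτ (hdens a) (d := d a) (W := W)
      (by rw [Measure.map_apply (hmeas a) measurableSet_Iic]; exact hq a) hb (hg a) (hd a)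
    rwa [integral_map (hmeas a).aemeasurable
      (measurable_excessLoss τ (d a)).aestronglyMeasurable] at h
  -- The range [-|d a|, |d a|] gives the parameter d_a², the same quantity that bounds the mean from
  -- below.
  have hsub : ∀ a ∈ Finset.univ, HasSubgaussianMGF (fun e => -(Z a e - ∫ e', Z a e' ∂Q))
      (((‖|d a| - -|d a|‖₊) / 2) ^ 2) Q := fun a _ =>
    (hasSubgaussianMGF_of_mem_Icc (hZm a).aemeasurable
      (ae_of_all _ fun e => abs_le.1 (abs_excessLoss_le hτ (d a) (e a)))).neg
  have hindZ : iIndepFun (fun a e => -(Z a e - ∫ e', Z a e' ∂Q)) Q :=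
    hind.comp (fun a u => -(excessLoss τ (d a) u - ∫ e', Z a e' ∂Q)) fun a =>
      ((measurable_excessLoss τ (d a)).sub_const _).neg
  have hD : 0 ≤ ∑ a, d a ^ 2 := Finset.sum_nonneg fun a _ => sq_nonneg _
  -- The deviation b/8 ∑ d_a² separates the mean, at least b/4 ∑ d_a², from the threshold b/8 ∑
  -- d_a².
  have hoef := HasSubgaussianMGF.measure_sum_ge_le_of_iIndepFun hindZ hsub
    (ε := b / 8 * ∑ a, d a ^ 2) (by positivity)
  have hc : ((∑ a, ((‖|d a| - -|d a|‖₊) / 2) ^ 2 : NNReal) : ℝ) = ∑ a, d a ^ 2 := by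
    push_cast
    refine Finset.sum_congr rfl fun a _ => ?_
    rw [Real.norm_eq_abs, sub_neg_eq_add, ← two_mul, abs_mul, abs_abs, abs_two,
      mul_div_cancel_left₀ _ two_ne_zero, sq_abs]
  refine (measureReal_mono fun e he => ?_).trans (hoef.trans (Real.exp_le_exp.2 ?_))
  · simp only [Set.mem_ofPred_eq] at he ⊢
    have h1 : b / 4 * ∑ a, d a ^ 2 ≤ ∑ a, ∫ e, Z a e ∂Q := by
      rw [Finset.mul_sum]
      exact Finset.sum_le_sum fun a _ => hmean a
    rw [Finset.sum_neg_distrib, Finset.sum_sub_distrib]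
    linarith
  · rw [hc]
    -- Hoeffding's exponent has ∑ d_a² in its denominator, so the zero shift is treated apart.
    rcases hD.eq_or_lt with h | h
    · simp [← h]
    · apply le_of_eq
      field_simp
      ring

/-! ### Discretization of the parameters -/

/-- A finite `δ`-net of the interval `[-M, M]`. -/
theorem exists_grid {M δ : ℝ} (hM : 0 < M) (hδ : 0 < δ) :
    ∃ s : Finset ℝ, (s.card : ℝ) ≤ 2 * M / δ + 3 ∧ (∀ y ∈ s, |y| ≤ M) ∧
      ∀ x, |x| ≤ M → ∃ y ∈ s, |x - y| ≤ δ := by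
  classical
  set m : ℕ := ⌈M / δ⌉₊ with hm
  have hm0 : 0 < m := Nat.ceil_pos.2 (by positivity)
  have hm0' : (0 : ℝ) < m := by exact_mod_cast hm0
  have hmlt : (m : ℝ) < M / δ + 1 := Nat.ceil_lt_add_one (by positivity)
  have hmge : M / δ ≤ m := Nat.le_ceil _
  refine ⟨(Finset.Icc (-(m : ℤ)) m).image fun i : ℤ => M * i / m, ?_, ?_, ?_⟩
  · have h1 : ((Finset.Icc (-(m : ℤ)) m).image fun i : ℤ => M * i / m).card ≤ 2 * m + 1 := by
      refine Finset.card_image_le.trans ?_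
      rw [Int.card_Icc]
      omega
    have h2 : (((Finset.Icc (-(m : ℤ)) m).image fun i : ℤ => M * i / m).card : ℝ)
        ≤ 2 * m + 1 := by exact_mod_cast h1
    rw [mul_div_assoc]
    linarith
  · simp only [Finset.mem_image, Finset.mem_Icc, forall_exists_index, and_imp]
    rintro y i h1 h2 rfl
    have h1' : -(m : ℝ) ≤ i := by exact_mod_cast h1
    have h2' : (i : ℝ) ≤ m := by exact_mod_cast h2
    rw [abs_div, abs_mul, abs_of_pos hM, abs_of_pos hm0', div_le_iff₀ hm0']
    exact mul_le_mul_of_nonneg_left (abs_le.2 ⟨h1', h2'⟩) hM.le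
  · intro x hx
    rw [abs_le] at hx
    have hlow := Int.floor_le (x * m / M)
    have hupp := Int.lt_floor_add_one (x * m / M)
    refine ⟨M * ⌊x * m / M⌋ / m, Finset.mem_image.2 ⟨⌊x * m / M⌋, Finset.mem_Icc.2 ⟨?_, ?_⟩, rfl⟩,
      ?_⟩
    · rw [Int.le_floor, le_div_iff₀ hM]
      push_cast
      nlinarith
    · have : x * m / M ≤ m := by
        rw [div_le_iff₀ hM]
        nlinarith
      exact_mod_cast (Int.floor_le _).trans this
    · have e : x - M * ⌊x * m / M⌋ / m = M / m * (x * m / M - ⌊x * m / M⌋) := by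
        field_simp
      have h3 : M / m ≤ δ := by
        rw [div_le_iff₀ hm0', mul_comm]
        rwa [div_le_iff₀ hδ] at hmge
      rw [e, abs_of_nonneg (mul_nonneg (by positivity) (by linarith))]
      calc M / m * (x * m / M - ⌊x * m / M⌋) ≤ M / m * 1 :=
            mul_le_mul_of_nonneg_left (by linarith) (by positivity)
        _ ≤ δ := by linarith

/-- Positions of the scalar entries of a parameter. -/
abbrev ParamIndex (p1 p2 T l1 l2 : ℕ) : Type :=
  (Fin p1 × Fin l1) ⊕ (Fin T × Fin l1 × Fin l2) ⊕ (Fin p2 × Fin l2)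

/-- The scalar entries of a parameter. -/
def Param.entries {p1 p2 T l1 l2 : ℕ} (θ : Param p1 p2 T l1 l2) : ParamIndex p1 p2 T l1 l2 → ℝ
  | Sum.inl x => θ.R x.1 x.2
  | Sum.inr (Sum.inl x) => θ.F x.1 x.2.1 x.2.2
  | Sum.inr (Sum.inr x) => θ.C x.1 x.2

/-- The parameter with given scalar entries. -/
def Param.ofEntries {p1 p2 T l1 l2 : ℕ} (q : ParamIndex p1 p2 T l1 l2 → ℝ) :
    Param p1 p2 T l1 l2 where
  R := fun i a => q (Sum.inl (i, a))
  F := fun t a b => q (Sum.inr (Sum.inl (t, a, b)))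
  C := fun j b => q (Sum.inr (Sum.inr (j, b)))

theorem Param.entries_ofEntries {p1 p2 T l1 l2 : ℕ} (q : ParamIndex p1 p2 T l1 l2 → ℝ) :
    (Param.ofEntries q).entries = q := by
  funext x
  rcases x with x | x | x <;> rfl

theorem Param.common_apply {p1 p2 T l1 l2 : ℕ} (θ : Param p1 p2 T l1 l2) (t : Fin T) (i : Fin p1)
    (j : Fin p2) : θ.common t i j = ∑ b, ∑ a, θ.R i a * θ.F t a b * θ.C j b := by
  simp [Param.common, Matrix.mul_apply, Finset.sum_mul]

theorem Param.abs_common_le {p1 p2 T l1 l2 : ℕ} {θ : Param p1 p2 T l1 l2} {M : ℝ}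
    (h : ∀ x, |θ.entries x| ≤ M) (t : Fin T) (i : Fin p1) (j : Fin p2) :
    |θ.common t i j| ≤ l1 * l2 * M ^ 3 := by
  have hterm : ∀ b a, |θ.R i a * θ.F t a b * θ.C j b| ≤ M ^ 3 := fun b a => by
    have h1 : |θ.R i a| ≤ M := h (Sum.inl (i, a))
    have h2 : |θ.F t a b| ≤ M := h (Sum.inr (Sum.inl (t, a, b)))
    have h3 : |θ.C j b| ≤ M := h (Sum.inr (Sum.inr (j, b)))
    have hM : 0 ≤ M := (abs_nonneg _).trans h1
    rw [abs_mul, abs_mul, pow_succ, sq]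
    gcongr
  rw [θ.common_apply]
  calc |∑ b, ∑ a, θ.R i a * θ.F t a b * θ.C j b|
      ≤ ∑ b : Fin l2, ∑ a : Fin l1, M ^ 3 :=
        (Finset.abs_sum_le_sum_abs _ _).trans (Finset.sum_le_sum fun b _ =>
          (Finset.abs_sum_le_sum_abs _ _).trans (Finset.sum_le_sum fun a _ => hterm b a))
    _ = l1 * l2 * M ^ 3 := by simp; ring

theorem abs_mul_mul_sub_le {x y z x' y' z' M δ : ℝ} (hy : |y| ≤ M) (hz : |z| ≤ M)
    (hx' : |x'| ≤ M) (hy' : |y'| ≤ M) (dx : |x - x'| ≤ δ) (dy : |y - y'| ≤ δ)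
    (dz : |z - z'| ≤ δ) : |x * y * z - x' * y' * z'| ≤ 3 * M ^ 2 * δ := by
  have hM : 0 ≤ M := (abs_nonneg _).trans hy
  have hδ : 0 ≤ δ := (abs_nonneg _).trans dx
  have e : x * y * z - x' * y' * z'
      = (x - x') * y * z + x' * (y - y') * z + x' * y' * (z - z') := by ring
  have h1 : |(x - x') * y * z| ≤ δ * M * M := by rw [abs_mul, abs_mul]; gcongr
  have h2 : |x' * (y - y') * z| ≤ M * δ * M := by rw [abs_mul, abs_mul]; gcongr
  have h3 : |x' * y' * (z - z')| ≤ M * M * δ := by rw [abs_mul, abs_mul]; gcongr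
  rw [e]
  refine (abs_add_three _ _ _).trans ?_
  linarith

theorem Param.abs_common_sub_le {p1 p2 T l1 l2 : ℕ} {θ θ' : Param p1 p2 T l1 l2} {M δ : ℝ}
    (h : ∀ x, |θ.entries x| ≤ M) (h' : ∀ x, |θ'.entries x| ≤ M)
    (hd : ∀ x, |θ.entries x - θ'.entries x| ≤ δ) (t : Fin T) (i : Fin p1) (j : Fin p2) :
    |θ.common t i j - θ'.common t i j| ≤ l1 * l2 * (3 * M ^ 2 * δ) := by
  have hterm : ∀ b a, |θ.R i a * θ.F t a b * θ.C j b - θ'.R i a * θ'.F t a b * θ'.C j b|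
      ≤ 3 * M ^ 2 * δ := fun b a =>
    abs_mul_mul_sub_le (h (Sum.inr (Sum.inl (t, a, b)))) (h (Sum.inr (Sum.inr (j, b))))
      (h' (Sum.inl (i, a))) (h' (Sum.inr (Sum.inl (t, a, b)))) (hd (Sum.inl (i, a)))
      (hd (Sum.inr (Sum.inl (t, a, b)))) (hd (Sum.inr (Sum.inr (j, b))))
  rw [θ.common_apply, θ'.common_apply, ← Finset.sum_sub_distrib]
  simp_rw [← Finset.sum_sub_distrib]
  calc |∑ b, ∑ a, (θ.R i a * θ.F t a b * θ.C j b - θ'.R i a * θ'.F t a b * θ'.C j b)|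
      ≤ ∑ b : Fin l2, ∑ a : Fin l1, 3 * M ^ 2 * δ :=
        (Finset.abs_sum_le_sum_abs _ _).trans (Finset.sum_le_sum fun b _ =>
          (Finset.abs_sum_le_sum_abs _ _).trans (Finset.sum_le_sum fun a _ => hterm b a))
    _ = l1 * l2 * (3 * M ^ 2 * δ) := by simp; ring

/-- The difference of two common components, as one array. -/
def shift {p1 p2 T l1 l2 m1 m2 : ℕ} (θ : Param p1 p2 T l1 l2) (θ0 : Param p1 p2 T m1 m2) :
    Fin p1 × Fin p2 × Fin T → ℝ :=
  fun a => θ.common a.2.2 a.1 a.2.1 - θ0.common a.2.2 a.1 a.2.1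

theorem meanSq_eq_sum_shift {p1 p2 T l1 l2 m1 m2 : ℕ} (θ : Param p1 p2 T l1 l2)
    (θ0 : Param p1 p2 T m1 m2) :
    meanSq θ θ0 = ((p1 : ℝ) * p2 * T)⁻¹ * ∑ a, shift θ θ0 a ^ 2 := by
  unfold meanSq shift
  congr 1
  rw [Fintype.sum_prod_type]
  simp_rw [Fintype.sum_prod_type]
  rw [Finset.sum_comm]
  exact Finset.sum_congr rfl fun i _ => Finset.sum_comm

theorem sum_excessLoss_shift {p1 p2 T l1 l2 m1 m2 : ℕ} (τ : ℝ)
    (X : Fin T → Matrix (Fin p1) (Fin p2) ℝ) (θ : Param p1 p2 T l1 l2)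
    (θ0 : Param p1 p2 T m1 m2) :
    ((p1 : ℝ) * p2 * T)⁻¹ * ∑ a, excessLoss τ (shift θ θ0 a) (errors X θ0 a)
      = empLoss τ X θ - empLoss τ X θ0 := by
  unfold empLoss
  rw [← mul_sub, ← Finset.sum_sub_distrib]
  congr 1
  simp_rw [← Finset.sum_sub_distrib, Fintype.sum_prod_type]
  refine Finset.sum_congr rfl fun i _ => Finset.sum_congr rfl fun j _ =>
    Finset.sum_congr rfl fun t _ => ?_
  simp only [excessLoss, errors, shift]
  congr 2
  ring

/-- Passing from a shift with nonpositive excess loss to a nearby one. -/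
theorem excessLoss_sum_le_of_near {ι : Type*} [Fintype ι] {τ : ℝ} (hτ : τ ∈ Set.Ioo (0 : ℝ) 1)
    {d d' e : ι → ℝ} {W η r b : ℝ} (hb : 0 < b) (hd : ∀ a, |d a| ≤ W) (hd' : ∀ a, |d' a| ≤ W)
    (hdd : ∀ a, |d a - d' a| ≤ η) (h1 : 2 * W * η ≤ r / 2) (h2 : η ≤ b / 16 * r)
    (hloss : ∑ a, excessLoss τ (d a) (e a) ≤ 0) (hsq : Fintype.card ι * r ≤ ∑ a, d a ^ 2) :
    Fintype.card ι * (r / 2) ≤ ∑ a, d' a ^ 2 ∧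
      ∑ a, excessLoss τ (d' a) (e a) ≤ b / 8 * ∑ a, d' a ^ 2 := by
  have hA : ∑ a, d a ^ 2 ≤ ∑ a, d' a ^ 2 + Fintype.card ι * (2 * W * η) := by
    have : ∑ a, d a ^ 2 ≤ ∑ a, (d' a ^ 2 + 2 * W * η) := by
      refine Finset.sum_le_sum fun a _ => ?_
      have e1 : d a ^ 2 - d' a ^ 2 = (d a + d' a) * (d a - d' a) := by ring
      have e2 : (d a + d' a) * (d a - d' a) ≤ (2 * W) * η := by
        refine (le_abs_self _).trans ?_
        rw [abs_mul]
        exact mul_le_mul ((abs_add_le _ _).trans (by linarith [hd a, hd' a])) (hdd a)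
          (abs_nonneg _) (by linarith [(abs_nonneg _).trans (hd a)])
      linarith
    rw [Finset.sum_add_distrib] at this
    simpa using this
  have hn : (0 : ℝ) ≤ Fintype.card ι := by positivity
  have hB := mul_le_mul_of_nonneg_left h1 hn
  have hC : Fintype.card ι * (r / 2) ≤ ∑ a, d' a ^ 2 := by linarith
  refine ⟨hC, ?_⟩
  have hD : ∑ a, excessLoss τ (d' a) (e a)
      ≤ ∑ a, excessLoss τ (d a) (e a) + Fintype.card ι * η := by
    have : ∑ a, excessLoss τ (d' a) (e a) ≤ ∑ a, (excessLoss τ (d a) (e a) + η) := by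
      refine Finset.sum_le_sum fun a _ => ?_
      have h3 := le_of_abs_le (abs_checkLoss_sub_le hτ (e a - d' a) (e a - d a))
      rw [sub_sub_sub_cancel_left] at h3
      simp only [excessLoss]
      linarith [hdd a]
    rw [Finset.sum_add_distrib] at this
    simpa using this
  -- With n the number of entries, the Lipschitz error is at most nη ≤ (b/8)(n r/2) ≤ (b/8) ∑ d'_a².
  have hE := mul_le_mul_of_nonneg_left h2 hn
  nlinarith

/-! ### Union bound conditionally on the factors -/

theorem measurable_matrix_entry {m n : ℕ} (a : Fin m) (b : Fin n) :
    Measurable fun M : Matrix (Fin m) (Fin n) ℝ => M a b :=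
  (measurable_pi_apply b).comp (measurable_pi_apply (X := fun _ : Fin m => Fin n → ℝ) a)

theorem measurable_common_truth {p1 p2 T k1 k2 : ℕ} (R0 : Matrix (Fin p1) (Fin k1) ℝ)
    (C0 : Matrix (Fin p2) (Fin k2) ℝ) (t : Fin T) (i : Fin p1) (j : Fin p2) :
    Measurable fun f : Fin T → Matrix (Fin k1) (Fin k2) ℝ => (truth R0 C0 f).common t i j := by
  simp_rw [Param.common_apply]
  refine Finset.measurable_fun_sum _ fun b _ => Finset.measurable_fun_sum _ fun a _ => ?_
  exact (((measurable_matrix_entry a b).comp (measurable_pi_apply t)).const_mul _).mul_const _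

theorem measurable_errors {p1 p2 T k1 k2 : ℕ} {Ω : Type*} [MeasurableSpace Ω]
    {X : Ω → Fin T → Matrix (Fin p1) (Fin p2) ℝ} (hX : Measurable X)
    (R0 : Matrix (Fin p1) (Fin k1) ℝ) (C0 : Matrix (Fin p2) (Fin k2) ℝ)
    {F0 : Ω → Fin T → Matrix (Fin k1) (Fin k2) ℝ} (hF0 : Measurable F0) :
    Measurable fun ω => errors (X ω) (truth R0 C0 (F0 ω)) :=
  measurable_pi_iff.2 fun a =>
    ((measurable_matrix_entry a.1 a.2.1).comp ((measurable_pi_apply a.2.2).comp hX)).sub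
      ((measurable_common_truth R0 C0 a.2.2 a.1 a.2.1).comp hF0)

/-- The event that the parameter `θ` is far from the truth and yet has a small excess loss. -/
def farEvent {p1 p2 T k1 k2 K1 K2 : ℕ} (τ b W r : ℝ) (θ : Param p1 p2 T K1 K2)
    (R0 : Matrix (Fin p1) (Fin k1) ℝ) (C0 : Matrix (Fin p2) (Fin k2) ℝ) :
    Set ((Fin T → Matrix (Fin k1) (Fin k2) ℝ) × (Fin p1 × Fin p2 × Fin T → ℝ)) :=
  {x | (∀ a, |shift θ (truth R0 C0 x.1) a| ≤ W) ∧
      p1 * p2 * T * (r / 2) ≤ ∑ a, shift θ (truth R0 C0 x.1) a ^ 2 ∧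
      ∑ a, excessLoss τ (shift θ (truth R0 C0 x.1) a) (x.2 a)
        ≤ b / 8 * ∑ a, shift θ (truth R0 C0 x.1) a ^ 2}

/-- The union of the events `farEvent` over the parameters with entries in the grid `s`. -/
def gridEvent {p1 p2 T k1 k2 : ℕ} (K1 K2 : ℕ) (τ b W r : ℝ) (s : Finset ℝ)
    (R0 : Matrix (Fin p1) (Fin k1) ℝ) (C0 : Matrix (Fin p2) (Fin k2) ℝ) :
    Set ((Fin T → Matrix (Fin k1) (Fin k2) ℝ) × (Fin p1 × Fin p2 × Fin T → ℝ)) :=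
  ⋃ q : ParamIndex p1 p2 T K1 K2 → s,
    farEvent τ b W r (Param.ofEntries fun y => (q y : ℝ)) R0 C0

theorem measurableSet_farEvent {p1 p2 T k1 k2 K1 K2 : ℕ} (τ b W r : ℝ) (θ : Param p1 p2 T K1 K2)
    (R0 : Matrix (Fin p1) (Fin k1) ℝ) (C0 : Matrix (Fin p2) (Fin k2) ℝ) :
    MeasurableSet (farEvent τ b W r θ R0 C0) := by
  have hsh : ∀ a, Measurable fun x : (Fin T → Matrix (Fin k1) (Fin k2) ℝ) ×
      (Fin p1 × Fin p2 × Fin T → ℝ) => shift θ (truth R0 C0 x.1) a := fun a =>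
    measurable_const.sub ((measurable_common_truth R0 C0 a.2.2 a.1 a.2.1).comp measurable_fst)
  have hex : ∀ a, Measurable fun x : (Fin T → Matrix (Fin k1) (Fin k2) ℝ) ×
      (Fin p1 × Fin p2 × Fin T → ℝ) => excessLoss τ (shift θ (truth R0 C0 x.1) a) (x.2 a) :=
    fun a => ((measurable_checkLoss τ).comp
      (((measurable_pi_apply a).comp measurable_snd).sub (hsh a))).sub
      ((measurable_checkLoss τ).comp ((measurable_pi_apply a).comp measurable_snd))
  have hsq := Finset.measurable_fun_sum Finset.univ fun a _ => (hsh a).pow_const 2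
  have h := (MeasurableSet.iInter fun a =>
    measurableSet_le (hsh a).abs (measurable_const (a := W))).inter
    ((measurableSet_le (measurable_const (a := p1 * p2 * T * (r / 2))) hsq).inter
      (measurableSet_le (Finset.measurable_fun_sum Finset.univ fun a _ => hex a)
        (hsq.const_mul (b / 8))))
  convert h using 1
  ext x
  simp [farEvent]

theorem measurableSet_gridEvent {p1 p2 T k1 k2 : ℕ} (K1 K2 : ℕ) (τ b W r : ℝ) (s : Finset ℝ)
    (R0 : Matrix (Fin p1) (Fin k1) ℝ) (C0 : Matrix (Fin p2) (Fin k2) ℝ) :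
    MeasurableSet (gridEvent (T := T) K1 K2 τ b W r s R0 C0) :=
  MeasurableSet.iUnion fun _ => measurableSet_farEvent ..

/-- The union bound over the grid, for a fixed value of the factors. -/
theorem measure_gridEvent_slice_le {p1 p2 T k1 k2 K1 K2 : ℕ} {τ b W r : ℝ}
    (hτ : τ ∈ Set.Ioo (0 : ℝ) 1) (hb : 0 < b) (s : Finset ℝ)
    (R0 : Matrix (Fin p1) (Fin k1) ℝ) (C0 : Matrix (Fin p2) (Fin k2) ℝ)
    (f : Fin T → Matrix (Fin k1) (Fin k2) ℝ)
    {Q : Measure (Fin p1 × Fin p2 × Fin T → ℝ)} [IsProbabilityMeasure Q]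
    {g : Fin p1 × Fin p2 × Fin T → ℝ → ℝ}
    (hind : iIndepFun
      (fun (a : Fin p1 × Fin p2 × Fin T) (e : Fin p1 × Fin p2 × Fin T → ℝ) => e a) Q)
    (hdens : ∀ a, Q.map (fun e => e a) = volume.withDensity (fun u => ENNReal.ofReal (g a u)))
    (hq : ∀ a, Q {e | e a ≤ 0} = ENNReal.ofReal τ)
    (hg : ∀ a, ∀ u ∈ Set.Icc (-W) W, b ≤ g a u) :
    Q (Prod.mk f ⁻¹' gridEvent K1 K2 τ b W r s R0 C0)
      ≤ ENNReal.ofReal ((s.card : ℝ) ^ (p1 * K1 + T * (K1 * K2) + p2 * K2)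
        * Real.exp (-(b ^ 2 / 256 * (p1 * p2 * T * r)))) := by
  rw [gridEvent, Set.preimage_iUnion]
  have hone : ∀ θ : Param p1 p2 T K1 K2, Q (Prod.mk f ⁻¹' farEvent τ b W r θ R0 C0)
      ≤ ENNReal.ofReal (Real.exp (-(b ^ 2 / 256 * (p1 * p2 * T * r)))) := by
    intro θ
    set d := shift θ (truth R0 C0 f) with hd
    by_cases hc : (∀ a, |d a| ≤ W) ∧ p1 * p2 * T * (r / 2) ≤ ∑ a, d a ^ 2
    · have hH := measureReal_sum_excessLoss_le hτ hind hdens hq hb hg d hc.1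
      have hle : Real.exp (-(b ^ 2 / 128 * ∑ a, d a ^ 2))
          ≤ Real.exp (-(b ^ 2 / 256 * (p1 * p2 * T * r))) := by
        refine Real.exp_le_exp.2 ?_
        nlinarith [mul_le_mul_of_nonneg_left hc.2 (sq_nonneg b)]
      refine (measure_mono (t := {e | ∑ a, excessLoss τ (d a) (e a) ≤ b / 8 * ∑ a, d a ^ 2})
        fun e he => he.2.2).trans ?_
      rw [← ofReal_measureReal]
      exact ENNReal.ofReal_le_ofReal (hH.trans hle)
    -- The first two conditions in `farEvent` do not involve the errors; if one fails, the slice is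
    -- empty.
    · have : Prod.mk f ⁻¹' farEvent τ b W r θ R0 C0 = ∅ :=
        Set.eq_empty_of_forall_notMem fun e he => hc ⟨he.1, he.2.1⟩
      rw [this, measure_empty]
      exact zero_le
  refine (measure_iUnion_fintype_le _ _).trans ((Finset.sum_le_sum fun q _ => hone _).trans ?_)
  rw [Finset.sum_const, nsmul_eq_mul, ENNReal.ofReal_mul (by positivity)]
  refine mul_le_mul_left (le_of_eq ?_) _
  rw [ENNReal.ofReal_pow (by positivity), ENNReal.ofReal_natCast]
  simp [Fintype.card_sum, Fintype.card_prod, add_assoc]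

/-- The mean squared error of a quantile fit exceeds `r` with small probability. -/
theorem measure_meanSq_ge_le {p1 p2 T k1 k2 K1 K2 : ℕ} (hp1 : 0 < p1) (hp2 : 0 < p2) (hT : 0 < T)
    {τ : ℝ} (hτ : τ ∈ Set.Ioo (0 : ℝ) 1) {Θ0 : Set (Param p1 p2 T k1 k2)}
    {Θ : Set (Param p1 p2 T K1 K2)} {M M0 W b r δ : ℝ}
    (hΘ0 : ∀ θ ∈ Θ0, ∀ x, |θ.entries x| ≤ M0) (hΘ : ∀ θ ∈ Θ, ∀ x, |θ.entries x| ≤ M)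
    (hW : K1 * K2 * M ^ 3 + k1 * k2 * M0 ^ 3 ≤ W) (hb : 0 < b)
    (h1 : 2 * W * (K1 * K2 * (3 * M ^ 2 * δ)) ≤ r / 2)
    (h2 : K1 * K2 * (3 * M ^ 2 * δ) ≤ b / 16 * r)
    {s : Finset ℝ} (hs : ∀ y ∈ s, |y| ≤ M) (hnet : ∀ x, |x| ≤ M → ∃ y ∈ s, |x - y| ≤ δ)
    {Ω : Type*} [MeasurableSpace Ω] (μ : Measure Ω) [IsProbabilityMeasure μ]
    {X : Ω → Fin T → Matrix (Fin p1) (Fin p2) ℝ} (hX : Measurable X)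
    {R0 : Matrix (Fin p1) (Fin k1) ℝ} {C0 : Matrix (Fin p2) (Fin k2) ℝ}
    {F0 : Ω → Fin T → Matrix (Fin k1) (Fin k2) ℝ} (hF0 : Measurable F0)
    (htrue : ∀ᵐ ω ∂μ, truth R0 C0 (F0 ω) ∈ Θ0)
    (hembed : ∀ᵐ ω ∂μ, ∃ θ ∈ Θ, ∀ t, θ.common t = (truth R0 C0 (F0 ω)).common t)
    {g : (Fin T → Matrix (Fin k1) (Fin k2) ℝ) → Fin p1 × Fin p2 × Fin T → ℝ → ℝ}
    (herr : ErrorLaw μ τ (fun ω => errors (X ω) (truth R0 C0 (F0 ω))) F0 g)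
    (hg : ∀ᵐ f ∂(μ.map F0), ∀ a, ∀ u ∈ Set.Icc (-W) W, b ≤ g f a u)
    {θhat : Ω → Param p1 p2 T K1 K2} (hθhat : ∀ᵐ ω ∂μ, IsQuantileFit τ (X ω) Θ (θhat ω)) :
    μ {ω | r ≤ meanSq (θhat ω) (truth R0 C0 (F0 ω))}
      ≤ ENNReal.ofReal ((s.card : ℝ) ^ (p1 * K1 + T * (K1 * K2) + p2 * K2)
        * Real.exp (-(b ^ 2 / 256 * (p1 * p2 * T * r)))) := by
  have hN : (0 : ℝ) < p1 * p2 * T := by positivity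
  have hε := measurable_errors hX R0 C0 hF0
  set E := gridEvent (T := T) K1 K2 τ b W r s R0 C0 with hE
  have hprob : IsProbabilityMeasure (μ.map F0) := Measure.isProbabilityMeasure_map hF0.aemeasurable
  calc μ {ω | r ≤ meanSq (θhat ω) (truth R0 C0 (F0 ω))}
      ≤ μ ((fun ω => (F0 ω, errors (X ω) (truth R0 C0 (F0 ω)))) ⁻¹' E) := by
        -- No measurability of `θhat` is available. The inclusion replaces the event by a preimage
        -- of `E`, a finite union of measurable sets, so that the joint law can be disintegrated.
        refine measure_mono_ae ?_
        filter_upwards [htrue, hembed, hθhat] with ω h0 ⟨θ1, hθ1, hcom⟩ ⟨hmem, hmin⟩ hr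
        have hr : r ≤ meanSq (θhat ω) (truth R0 C0 (F0 ω)) := hr
        have hle : empLoss τ (X ω) (θhat ω) ≤ empLoss τ (X ω) (truth R0 C0 (F0 ω)) := by
          have : empLoss τ (X ω) θ1 = empLoss τ (X ω) (truth R0 C0 (F0 ω)) := by
            simp only [empLoss, hcom]
          rw [← this]
          exact hmin hθ1
        choose q hqs hqd using fun x => hnet _ (hΘ _ hmem x)
        -- The grid point may violate the normalizations of `Θ`; only the bound on its entries
        -- matters.
        set θ' : Param p1 p2 T K1 K2 := Param.ofEntries q with hθ'
        have hθ'M : ∀ x, |θ'.entries x| ≤ M := fun x => by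
          rw [hθ', Param.entries_ofEntries]
          exact hs _ (hqs x)
        have hθ'd : ∀ x, |(θhat ω).entries x - θ'.entries x| ≤ δ := fun x => by
          rw [hθ', Param.entries_ofEntries]
          exact hqd x
        have hsh : ∀ θ : Param p1 p2 T K1 K2, (∀ x, |θ.entries x| ≤ M) → ∀ a,
            |shift θ (truth R0 C0 (F0 ω)) a| ≤ W := fun θ hθ a =>
          (abs_sub _ _).trans ((add_le_add (Param.abs_common_le hθ _ _ _)
            (Param.abs_common_le (hΘ0 _ h0) _ _ _)).trans hW)
        have hcard : (Fintype.card (Fin p1 × Fin p2 × Fin T) : ℝ) = p1 * p2 * T := by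
          simp [mul_assoc]
        have hnear := excessLoss_sum_le_of_near hτ (e := errors (X ω) (truth R0 C0 (F0 ω))) hb
          (hsh _ (hΘ _ hmem)) (hsh _ hθ'M)
          (fun a => by
            simpa [shift] using
              Param.abs_common_sub_le (hΘ _ hmem) hθ'M hθ'd a.2.2 a.1 a.2.1) h1 h2
          (by
            have h3 := sum_excessLoss_shift τ (X ω) (θhat ω) (truth R0 C0 (F0 ω))
            have h4 := inv_pos.2 hN
            by_contra hcon
            have := mul_pos h4 (not_le.1 hcon)
            linarith)
          (by
            rw [hcard]
            rw [meanSq_eq_sum_shift, inv_mul_eq_div, le_div_iff₀ hN] at hr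
            linarith)
        rw [hcard] at hnear
        exact Set.mem_iUnion.2 ⟨fun x => ⟨q x, hqs x⟩, hsh _ hθ'M, hnear⟩
    _ = (μ.map fun ω => (F0 ω, errors (X ω) (truth R0 C0 (F0 ω)))) E :=
        (Measure.map_apply (hF0.prodMk hε) (measurableSet_gridEvent ..)).symm
    _ = ∫⁻ f, condDistrib (fun ω => errors (X ω) (truth R0 C0 (F0 ω))) F0 μ f (Prod.mk f ⁻¹' E)
          ∂(μ.map F0) := by
        -- Given the factors, the shift of a grid point is deterministic, so the tail bound applies
        -- slice by slice.
        rw [← compProd_map_condDistrib hε.aemeasurable,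
          Measure.compProd_apply (measurableSet_gridEvent ..)]
    _ ≤ ∫⁻ _, ENNReal.ofReal ((s.card : ℝ) ^ (p1 * K1 + T * (K1 * K2) + p2 * K2)
        * Real.exp (-(b ^ 2 / 256 * (p1 * p2 * T * r)))) ∂(μ.map F0) := by
        refine lintegral_mono_ae ?_
        filter_upwards [herr, hg] with f hf hgf
        exact measure_gridEvent_slice_le hτ hb s R0 C0 f hf.1 (fun a => (hf.2 a).2.1)
          (fun a => (hf.2 a).2.2) hgf
    _ = _ := by simp

/-! ### Uniform bounds and the eigenvalue-ratio criterion -/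

theorem exists_abs_le_of_isCompact {X ι : Type*} [TopologicalSpace X] [Fintype ι] {S : Set X}
    (hS : IsCompact S) (φ : ι → X → ℝ) (hφ : ∀ i, Continuous (φ i)) :
    ∃ M, ∀ x ∈ S, ∀ i, |φ i x| ≤ M := by
  obtain ⟨M, hM⟩ := hS.exists_bound_of_continuousOn (f := fun x i => φ i x)
    (continuous_pi hφ).continuousOn
  exact ⟨M, fun x hx i => (norm_le_pi_norm (fun i => φ i x) i).trans (hM x hx)⟩

theorem exists_entries_bound {l1 l2 : ℕ} {A : Set (Fin l1 → ℝ)}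
    {S : Set (Matrix (Fin l1) (Fin l2) ℝ)} {B : Set (Fin l2 → ℝ)} (hA : IsCompact A)
    (hS : IsCompact S) (hB : IsCompact B) :
    ∃ M : ℝ, 0 < M ∧ ∀ p1 p2 T, ∀ θ ∈ paramSpace p1 p2 T A S B, ∀ x, |θ.entries x| ≤ M := by
  obtain ⟨M1, h1⟩ := exists_abs_le_of_isCompact hA (fun i x => x i) continuous_apply
  obtain ⟨M2, h2⟩ := exists_abs_le_of_isCompact hS
    (fun (i : Fin l1 × Fin l2) x => x i.1 i.2) fun i => continuous_id.matrix_elem i.1 i.2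
  obtain ⟨M3, h3⟩ := exists_abs_le_of_isCompact hB (fun i x => x i) continuous_apply
  refine ⟨max (max M1 M2) (max M3 1), by simp, fun p1 p2 T θ hθ x => ?_⟩
  rcases x with x | x | x
  · exact (h1 _ (hθ.1 x.1) x.2).trans ((le_max_left _ _).trans (le_max_left _ _))
  · exact (h2 _ (hθ.2.1 x.1) x.2).trans ((le_max_right _ _).trans (le_max_left _ _))
  · exact (h3 _ (hθ.2.2.1 x.1) x.2).trans ((le_max_left _ _).trans (le_max_right _ _))

/-- The normalizations imposed on the members of the parameter space. -/
def Param.IsNormalized {p1 p2 T l1 l2 : ℕ} (θ : Param p1 p2 T l1 l2) : Prop :=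
  (p1 : ℝ)⁻¹ • (θ.R.transpose * θ.R) = 1 ∧ (p2 : ℝ)⁻¹ • (θ.C.transpose * θ.C) = 1 ∧
    IsDescendingDiag (rowGram θ.F) ∧ IsDescendingDiag (colGram θ.F)

theorem Param.IsNormalized.transpose {p1 p2 T l1 l2 : ℕ} {θ : Param p1 p2 T l1 l2}
    (h : θ.IsNormalized) : θ.transpose.IsNormalized := by
  refine ⟨h.2.1, h.1, ?_, ?_⟩
  · rw [Param.rowGram_transpose]
    exact h.2.2.2
  · exact h.2.2.1

theorem meanSq_comm {p1 p2 T l1 l2 m1 m2 : ℕ} (θ : Param p1 p2 T l1 l2)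
    (θ' : Param p1 p2 T m1 m2) : meanSq θ θ' = meanSq θ' θ := by
  unfold meanSq
  simp_rw [sub_sq_comm]

theorem rowGram_diag_le {T l1 l2 : ℕ} (hT : 0 < T) {F : Fin T → Matrix (Fin l1) (Fin l2) ℝ} {M : ℝ}
    (h : ∀ t a b, |F t a b| ≤ M) (a : Fin l1) : rowGram F a a ≤ l2 * M ^ 2 := by
  have hT' : (0 : ℝ) < T := by exact_mod_cast hT
  simp only [rowGram, Matrix.smul_apply, Matrix.sum_apply, Matrix.mul_apply,
    Matrix.transpose_apply, smul_eq_mul]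
  rw [inv_mul_le_iff₀ hT']
  calc ∑ t, ∑ b, F t a b * F t a b ≤ ∑ t : Fin T, ∑ b : Fin l2, M ^ 2 := by
        refine Finset.sum_le_sum fun t _ => Finset.sum_le_sum fun b _ => ?_
        rw [← sq]
        exact sq_le_sq' (abs_le.1 (h t a b)).1 (abs_le.1 (h t a b)).2
    _ = T * (l2 * M ^ 2) := by simp

theorem diagEntry_anti {l : ℕ} {M : Matrix (Fin l) (Fin l) ℝ} (h : IsDescendingDiag M) {j k : ℕ}
    (hj : 1 ≤ j) (hjk : j ≤ k) (hk : k ≤ l) : diagEntry M k ≤ diagEntry M j := by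
  rw [diagEntry, dif_pos ⟨hj.trans hjk, hk⟩, diagEntry, dif_pos ⟨hj, hjk.trans hk⟩]
  exact h.2 (Fin.mk_le_mk.2 (Nat.sub_le_sub_right hjk 1))

/-- The eigenvalue ratio is maximal at `k` when the spectrum has a sufficient gap after `k`. -/
theorem IsERChoice.eq_of_gap {l : ℕ} {M : Matrix (Fin l) (Fin l) ℝ} {c0 L s u B : ℝ} {k k' : ℕ}
    (h : IsERChoice M c0 L k') (hM : IsDescendingDiag M) (hnn : ∀ a, 0 ≤ M a a) (hk : 1 ≤ k)
    (hkl : k < l) (hc0 : 0 < c0) (hL : 0 < L) (hs : 0 < s) (hsk : s ≤ diagEntry M k)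
    (huk : diagEntry M (k + 1) ≤ u) (hB : diagEntry M 1 ≤ B)
    (h1 : B * (u + c0 * (L ^ 2)⁻¹) < s * s)
    (h2 : u * (u + c0 * (L ^ 2)⁻¹) < s * (c0 * (L ^ 2)⁻¹)) : k' = k := by
  obtain ⟨hmem, hmax⟩ := h
  rw [Finset.mem_Icc] at hmem
  have hnn' : ∀ j, 0 ≤ diagEntry M j := fun j => by
    unfold diagEntry
    split_ifs
    · exact hnn _
    · exact le_rfl
  set ε := c0 * (L ^ 2)⁻¹ with hε
  have hε0 : 0 < ε := by positivity
  have hu : 0 ≤ u := (hnn' _).trans huk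
  have hB0 : 0 ≤ B := (hnn' _).trans hB
  -- The ratio is at least s/(u + ε) at k, at most B/s before k and at most u/ε after k; `h1` and
  -- `h2` are the cross-multiplied comparisons.
  have hlow : s / (u + ε) ≤ eigRatio M c0 L k := by
    have := hnn' (k + 1)
    unfold eigRatio
    rw [← hε]
    exact div_le_div₀ (hnn' k) hsk (by linarith) (by linarith)
  have hk' := hlow.trans (hmax k (Finset.mem_Icc.2 ⟨hk, by omega⟩))
  rw [div_le_iff₀ (by positivity)] at hk'
  by_contra hne
  rcases lt_or_gt_of_ne hne with hlt | hgt
  · have hr : eigRatio M c0 L k' ≤ B / s := by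
      unfold eigRatio
      have e1 := (diagEntry_anti hM le_rfl hmem.1 (by omega)).trans hB
      have e2 := hsk.trans (diagEntry_anti hM (j := k' + 1) (by omega) hlt hkl.le)
      rw [← hε]
      exact div_le_div₀ hB0 e1 hs (by linarith)
    have := hk'.trans (mul_le_mul_of_nonneg_right hr (by positivity))
    rw [div_mul_eq_mul_div, le_div_iff₀ hs] at this
    linarith
  · have hr : eigRatio M c0 L k' ≤ u / ε := by
      unfold eigRatio
      have e1 := (diagEntry_anti hM (j := k + 1) (k := k') (by omega) hgt (by omega)).trans huk
      have e2 := hnn' (k' + 1)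
      rw [← hε]
      exact div_le_div₀ hu e1 hε0 (by linarith)
    have := hk'.trans (mul_le_mul_of_nonneg_right hr (by positivity))
    rw [div_mul_eq_mul_div, le_div_iff₀ hε0] at this
    linarith

/-! ### Asymptotics and convergence in probability -/

theorem tendsto_rateL {p1 p2 T : ℕ → ℕ} (hp1 : Tendsto p1 atTop atTop)
    (hp2 : Tendsto p2 atTop atTop) (hT : Tendsto T atTop atTop) :
    Tendsto (fun n => rateL (p1 n) (p2 n) (T n)) atTop atTop := by
  have h : ∀ {u v : ℕ → ℕ}, Tendsto u atTop atTop → Tendsto v atTop atTop →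
      Tendsto (fun n => √((u n : ℝ) * v n)) atTop atTop := fun hu hv =>
    Real.tendsto_sqrt_atTop.comp ((tendsto_natCast_atTop_atTop.comp hu).atTop_mul_atTop₀
      (tendsto_natCast_atTop_atTop.comp hv))
  refine tendsto_atTop.2 fun c => ?_
  filter_upwards [tendsto_atTop.1 (h hp1 hp2) c, tendsto_atTop.1 (h hp2 hT) c,
    tendsto_atTop.1 (h hp1 hT) c] with n h1 h2 h3
  exact le_min h1 (le_min h2 h3)

theorem rateL_sq_le {p1 p2 T : ℕ} :
    rateL p1 p2 T ^ 2 ≤ p1 * p2 ∧ rateL p1 p2 T ^ 2 ≤ p2 * T ∧ rateL p1 p2 T ^ 2 ≤ p1 * T := by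
  have h0 : 0 ≤ rateL p1 p2 T := by unfold rateL; positivity
  refine ⟨?_, ?_, ?_⟩ <;> rw [← Real.le_sqrt h0 (by positivity)] <;> unfold rateL <;> simp

/-- The size of the grid is negligible against the exponential tail bound. -/
theorem eventually_pow_mul_exp_le (G c K : ℝ) (hG : 1 ≤ G) (hc : 0 < c) (hK : 0 ≤ K) :
    ∀ᶠ t : ℝ in atTop, ∀ p1 p2 T d m : ℕ, 0 < T → t ^ 4 ≤ p1 * p2 → t ^ 4 ≤ p2 * T →
      t ^ 4 ≤ p1 * T → (d : ℝ) ≤ K * (p1 + p2 + T) → (m : ℝ) ≤ G * t ^ 3 →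
      (m : ℝ) ^ d * Real.exp (-(c * (p1 * p2 * T * (t ^ 3)⁻¹))) ≤ Real.exp (-(c / 2 * t)) := by
  have hlim : Tendsto (fun t : ℝ => 3 * K * (Real.log G * t⁻¹ + 3 * (Real.log t / t))) atTop
      (𝓝 (3 * K * (Real.log G * 0 + 3 * 0))) :=
    ((tendsto_inv_atTop_zero.const_mul _).add
      ((Real.isLittleO_log_id_atTop.tendsto_div_nhds_zero).const_mul 3)).const_mul _
  have hev := hlim.eventually (gt_mem_nhds
    (show 3 * K * (Real.log G * 0 + 3 * 0) < c / 2 by simpa using hc))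
  filter_upwards [hev, eventually_ge_atTop 1] with t ht ht1 p1 p2 T d m hT h12 h2T h1T hd hm
  have ht0 : 0 < t := by linarith
  have hT1 : (1 : ℝ) ≤ T := by exact_mod_cast hT
  set N : ℝ := p1 * p2 * T with hN
  have hbase : 1 ≤ G * t ^ 3 := one_le_mul_of_one_le_of_one_le hG (one_le_pow₀ ht1)
  have hpow : (m : ℝ) ^ d ≤ Real.exp (d * Real.log (G * t ^ 3)) := by
    rw [mul_comm, Real.exp_mul, Real.exp_log (by linarith), Real.rpow_natCast]
    exact pow_le_pow_left₀ (by positivity) hm d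
  have hlog : 0 ≤ Real.log (G * t ^ 3) := Real.log_nonneg hbase
  -- Each dimension is multiplied by the pairwise product of the other two, which is at least t⁴.
  have hsum : (p1 + p2 + T : ℝ) * t ^ 4 ≤ 3 * N := by
    have e1 := mul_le_mul_of_nonneg_left h2T (Nat.cast_nonneg (α := ℝ) p1)
    have e2 := mul_le_mul_of_nonneg_left h1T (Nat.cast_nonneg (α := ℝ) p2)
    have e3 := mul_le_mul_of_nonneg_left h12 (Nat.cast_nonneg (α := ℝ) T)
    rw [hN]
    nlinarith
  have hNt : t ^ 4 ≤ N := by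
    rw [hN]
    exact h12.trans (le_mul_of_one_le_right (by positivity) hT1)
  have hNr : t ≤ N * (t ^ 3)⁻¹ := by
    rw [← div_eq_mul_inv, le_div_iff₀ (by positivity)]
    linarith [hNt, show t * t ^ 3 = t ^ 4 by ring]
  -- Since N t⁻⁴ log t = (N t⁻³)(log t / t), the entropy uses at most half of the exponent c N t⁻³.
  have hd2 : (d : ℝ) * Real.log (G * t ^ 3) ≤ c / 2 * (N * (t ^ 3)⁻¹) := by
    have hdN : (d : ℝ) ≤ 3 * K * (N * (t ^ 4)⁻¹) := by
      rw [← div_eq_mul_inv, ← mul_div_assoc, le_div_iff₀ (by positivity)]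
      nlinarith [mul_le_mul_of_nonneg_left hsum hK,
        mul_le_mul_of_nonneg_right hd (show 0 ≤ t ^ 4 by positivity)]
    have hl : Real.log (G * t ^ 3) = Real.log G + 3 * Real.log t := by
      rw [Real.log_mul (by positivity) (by positivity), Real.log_pow]
      norm_num
    have e : 3 * K * (N * (t ^ 4)⁻¹) * Real.log (G * t ^ 3)
        = 3 * K * (Real.log G * t⁻¹ + 3 * (Real.log t / t)) * (N * (t ^ 3)⁻¹) := by
      rw [hl]
      field_simp
    calc (d : ℝ) * Real.log (G * t ^ 3) ≤ 3 * K * (N * (t ^ 4)⁻¹) * Real.log (G * t ^ 3) :=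
          mul_le_mul_of_nonneg_right hdN hlog
      _ ≤ _ := by
          rw [e]
          exact mul_le_mul_of_nonneg_right ht.le (by linarith)
  calc (m : ℝ) ^ d * Real.exp (-(c * (N * (t ^ 3)⁻¹)))
      ≤ Real.exp (d * Real.log (G * t ^ 3)) * Real.exp (-(c * (N * (t ^ 3)⁻¹))) := by gcongr
    _ ≤ Real.exp (-(c / 2 * t)) := by
        rw [← Real.exp_add, Real.exp_le_exp]
        nlinarith [mul_le_mul_of_nonneg_left hNr hc.le]

/-- Here t stands for √L, so u = 2t⁻³ and ε = c0 t⁻⁴. The decisive comparison is t⁻⁶ against t⁻⁴ in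
the second inequality; divided by t⁻⁴, it becomes the limit of 4y² + 2 c0 y³ at y = 1/t. -/
theorem eventually_gap {s c0 : ℝ} (B : ℝ) (hs : 0 < s) (hc0 : 0 < c0) :
    ∀ᶠ t : ℝ in atTop, B * (2 * (t ^ 3)⁻¹ + c0 * (t ^ 4)⁻¹) < s * s ∧
      2 * (t ^ 3)⁻¹ * (2 * (t ^ 3)⁻¹ + c0 * (t ^ 4)⁻¹) < s * (c0 * (t ^ 4)⁻¹) ∧
      (t ^ 3)⁻¹ ≤ s := by
  have hlim : ∀ f : ℝ → ℝ, Continuous f → f 0 = 0 →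
      Tendsto (fun t : ℝ => f t⁻¹) atTop (𝓝 0) := fun f hf h0 => by
    have := (hf.tendsto 0).comp tendsto_inv_atTop_zero
    rwa [h0] at this
  have h1 := (hlim (fun y => B * (2 * y ^ 3 + c0 * y ^ 4)) (by fun_prop) (by simp)).eventually
    (gt_mem_nhds (mul_pos hs hs))
  have h2 := (hlim (fun y => 4 * y ^ 2 + 2 * c0 * y ^ 3) (by fun_prop) (by simp)).eventually
    (gt_mem_nhds (mul_pos hs hc0))
  have h3 := (hlim (fun y => y ^ 3) (by fun_prop) (by simp)).eventually (gt_mem_nhds hs)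
  filter_upwards [h1, h2, h3, eventually_gt_atTop 0] with t h1 h2 h3 ht
  have hy : 0 < t⁻¹ := inv_pos.2 ht
  simp only [← inv_pow]
  refine ⟨h1, ?_, h3.le⟩
  nlinarith [mul_lt_mul_of_pos_right h2 (pow_pos hy 4)]

/-- The mean-square rate at which quantile fits are shown to converge. -/
noncomputable def fitRate (p1 p2 T : ℕ) : ℝ := (√(rateL p1 p2 T) ^ 3)⁻¹

/-- Consistency of the eigenvalue-ratio estimator of the number of row factors, given a rate of
convergence of the common components. -/
theorem tendsto_measure_ne_of_isERChoice {k1 k2 K1 K2 : ℕ} (hk1 : 1 ≤ k1) (hK1 : k1 < K1)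
    {c0 : ℝ} (hc0 : 0 < c0) {p1 p2 T : ℕ → ℕ} (hp1 : Tendsto p1 atTop atTop)
    (hp2 : Tendsto p2 atTop atTop) (hT : Tendsto T atTop atTop)
    (hL : Tendsto (fun n => √(rateL (p1 n) (p2 n) (T n))) atTop atTop)
    {Ω : ℕ → Type*} [∀ n, MeasurableSpace (Ω n)] (μ : ∀ n, Measure (Ω n))
    {θ0 : ∀ n, Ω n → Param (p1 n) (p2 n) (T n) k1 k2}
    {θhat : ∀ n, Ω n → Param (p1 n) (p2 n) (T n) K1 K2}
    (h0 : ∀ n, ∀ᵐ ω ∂(μ n), (θ0 n ω).IsNormalized)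
    (hhat : ∀ n, ∀ᵐ ω ∂(μ n), (θhat n ω).IsNormalized) {M : ℝ}
    (hM : ∀ n, ∀ᵐ ω ∂(μ n), ∀ t a b, |(θhat n ω).F t a b| ≤ M)
    {σ : ℝ} (hσ : 0 < σ)
    (hσlim : Tendsto (fun n => μ n {ω | σ / 2 ≤
      |rowGram (θ0 n ω).F ⟨k1 - 1, by omega⟩ ⟨k1 - 1, by omega⟩ - σ|}) atTop (𝓝 0))
    (hfit : Tendsto (fun n => μ n {ω | fitRate (p1 n) (p2 n) (T n)
      ≤ meanSq (θhat n ω) (θ0 n ω)}) atTop (𝓝 0))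
    {khat : ∀ n, Ω n → ℕ}
    (hk : ∀ n, ∀ᵐ ω ∂(μ n),
      IsERChoice (rowGram (θhat n ω).F) c0 (rateL (p1 n) (p2 n) (T n)) (khat n ω)) :
    Tendsto (fun n => μ n {ω | khat n ω ≠ k1}) atTop (𝓝 0) := by
  have hsum := hfit.add hσlim
  rw [add_zero] at hsum
  refine tendsto_of_tendsto_of_tendsto_of_le_of_le' tendsto_const_nhds hsum
    (Eventually.of_forall fun _ => zero_le) ?_
  filter_upwards [hL.eventually (eventually_gap (K2 * M ^ 2) (s := σ / 8) (by positivity) hc0),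
    hL.eventually_gt_atTop 0, hp1.eventually_gt_atTop 0, hp2.eventually_gt_atTop 0,
    hT.eventually_gt_atTop 0] with n ⟨hg1, hg2, hg3⟩ ht hp1 hp2 hT
  refine (measure_mono_ae ?_).trans (measure_union_le _ _)
  filter_upwards [h0 n, hhat n, hM n, hk n] with ω h0 hhat hM hk hne
  by_contra hcon
  have hcon1 : meanSq (θhat n ω) (θ0 n ω) < fitRate (p1 n) (p2 n) (T n) :=
    not_le.1 fun h => hcon (Or.inl h)
  have hcon2 : |rowGram (θ0 n ω).F ⟨k1 - 1, by omega⟩ ⟨k1 - 1, by omega⟩ - σ| < σ / 2 :=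
    not_le.1 fun h => hcon (Or.inr h)
  have hL0 : 0 < rateL (p1 n) (p2 n) (T n) := Real.sqrt_pos.1 ht
  have hL4 : √(rateL (p1 n) (p2 n) (T n)) ^ 4 = rateL (p1 n) (p2 n) (T n) ^ 2 := by
    rw [show 4 = 2 * 2 from rfl, pow_mul, Real.sq_sqrt hL0.le]
  rw [hL4] at hg1 hg2
  have hd0 : diagEntry (rowGram (θ0 n ω).F) k1
      = rowGram (θ0 n ω).F ⟨k1 - 1, by omega⟩ ⟨k1 - 1, by omega⟩ := by
    rw [diagEntry, dif_pos ⟨hk1, le_rfl⟩]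
  -- Index k1 + 1 is out of range for the true parameter, so the default value serves as the missing
  -- eigenvalue.
  have hd1 : diagEntry (rowGram (θ0 n ω).F) (k1 + 1) = 0 := by
    rw [diagEntry, dif_neg (by omega)]
  have hlow := diagEntry_rowGram_le hp1 hp2 hT (θ0 n ω) (θhat n ω) h0.1 h0.2.1 h0.2.2.1 hhat.1
    hhat.2.1 hhat.2.2.1 hk1 le_rfl
  have hupp := diagEntry_rowGram_le hp1 hp2 hT (θhat n ω) (θ0 n ω) hhat.1 hhat.2.1 hhat.2.2.1
    h0.1 h0.2.1 h0.2.2.1 (k := k1 + 1) (by omega) hK1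
  rw [hd0, meanSq_comm] at hlow
  rw [hd1] at hupp
  rw [abs_lt] at hcon2
  unfold fitRate at hcon1
  -- The true entry exceeds σ/2, so the fitted one exceeds σ/4 - `meanSq`, and `meanSq` is below t⁻³
  -- ≤ σ/8.
  refine hne (hk.eq_of_gap hhat.2.2.1 (rowGram_diag_nonneg _) hk1 hK1 hc0 hL0
    (s := σ / 8) (u := 2 * (√(rateL (p1 n) (p2 n) (T n)) ^ 3)⁻¹) (B := K2 * M ^ 2)
    (by positivity) (by linarith [hcon2.1]) (by linarith) ?_ hg1 hg2)
  rw [diagEntry, dif_pos ⟨le_rfl, by omega⟩]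
  exact rowGram_diag_le hT hM _

/-- The common components of a quantile fit converge in mean square at the rate `fitRate`. -/
theorem tendsto_measure_fitRate_le_meanSq {τ : ℝ} (hτ : τ ∈ Set.Ioo (0 : ℝ) 1)
    {k1 k2 K1 K2 : ℕ} (hK1 : 0 < K1) (hK2 : 0 < K2)
    {p1 p2 T : ℕ → ℕ} (hp1 : Tendsto p1 atTop atTop) (hp2 : Tendsto p2 atTop atTop)
    (hT : Tendsto T atTop atTop)
    (hL : Tendsto (fun n => √(rateL (p1 n) (p2 n) (T n))) atTop atTop)
    {Θ0 : ∀ n, Set (Param (p1 n) (p2 n) (T n) k1 k2)}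
    {Θ : ∀ n, Set (Param (p1 n) (p2 n) (T n) K1 K2)} {M M0 : ℝ} (hM : 0 < M) (hM0 : 0 < M0)
    (hΘ0 : ∀ n, ∀ θ ∈ Θ0 n, ∀ x, |θ.entries x| ≤ M0)
    (hΘ : ∀ n, ∀ θ ∈ Θ n, ∀ x, |θ.entries x| ≤ M)
    {Ω : ℕ → Type*} [∀ n, MeasurableSpace (Ω n)]
    (μ : ∀ n, Measure (Ω n)) [∀ n, IsProbabilityMeasure (μ n)]
    {X : ∀ n, Ω n → Fin (T n) → Matrix (Fin (p1 n)) (Fin (p2 n)) ℝ}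
    (hX : ∀ n, Measurable (X n))
    {R0 : ∀ n, Matrix (Fin (p1 n)) (Fin k1) ℝ} {C0 : ∀ n, Matrix (Fin (p2 n)) (Fin k2) ℝ}
    {F0 : ∀ n, Ω n → Fin (T n) → Matrix (Fin k1) (Fin k2) ℝ}
    (hF0 : ∀ n, Measurable (F0 n))
    (htrue : ∀ n, ∀ᵐ ω ∂(μ n), truth (R0 n) (C0 n) (F0 n ω) ∈ Θ0 n)
    (hembed : ∀ n, ∀ᵐ ω ∂(μ n), ∃ θ ∈ Θ n,
      ∀ t, θ.common t = (truth (R0 n) (C0 n) (F0 n ω)).common t)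
    {g : ∀ n, (Fin (T n) → Matrix (Fin k1) (Fin k2) ℝ) →
      Fin (p1 n) × Fin (p2 n) × Fin (T n) → ℝ → ℝ}
    (herr : ∀ n, ErrorLaw (μ n) τ
      (fun ω => errors (X n ω) (truth (R0 n) (C0 n) (F0 n ω))) (F0 n) (g n))
    (hg : ∀ D : Set ℝ, IsCompact D → ∃ b : ℝ, 0 < b ∧
      ∀ n, ∀ᵐ f ∂((μ n).map (F0 n)), ∀ a, ∀ u ∈ D, b ≤ g n f a u)
    {θhat : ∀ n, Ω n → Param (p1 n) (p2 n) (T n) K1 K2}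
    (hθhat : ∀ n, ∀ᵐ ω ∂(μ n), IsQuantileFit τ (X n ω) (Θ n) (θhat n ω)) :
    Tendsto (fun n => μ n {ω | fitRate (p1 n) (p2 n) (T n)
      ≤ meanSq (θhat n ω) (truth (R0 n) (C0 n) (F0 n ω))}) atTop (𝓝 0) := by
  -- `W` bounds every shift, so the density is needed only on [-W, W].
  set W : ℝ := K1 * K2 * M ^ 3 + k1 * k2 * M0 ^ 3 with hW
  have hW0 : 0 < W := by positivity
  obtain ⟨b, hb, hgb⟩ := hg (Set.Icc (-W) W) isCompact_Icc
  set q : ℝ := K1 * K2 * (3 * M ^ 2) with hq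
  have hq0 : 0 < q := by positivity
  -- A mesh κr moves common components by at most qκr. The two terms of the minimum make this small
  -- enough for the squares and for the loss; a mesh proportional to r keeps the grid size
  -- polynomial in t.
  set κ : ℝ := min (1 / (4 * W * q)) (b / (16 * q)) with hκ
  have hκ0 : 0 < κ := by positivity
  have hκ1 : κ * (4 * W * q) ≤ 1 := by
    rw [← le_div_iff₀ (by positivity)]
    exact min_le_left _ _
  have hκ2 : κ * (16 * q) ≤ b := by
    rw [← le_div_iff₀ (by positivity)]
    exact min_le_right _ _
  have hbound := eventually_pow_mul_exp_le (2 * M / κ + 3) (b ^ 2 / 256) (K1 * K2)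
    (by linarith [show 0 < 2 * M / κ by positivity]) (by positivity) (by positivity)
  have hlim : Tendsto (fun n => ENNReal.ofReal
      (Real.exp (-(b ^ 2 / 256 / 2 * √(rateL (p1 n) (p2 n) (T n)))))) atTop (𝓝 0) := by
    rw [← ENNReal.ofReal_zero]
    refine ENNReal.tendsto_ofReal (Real.tendsto_exp_neg_atTop_nhds_zero.comp ?_)
    exact hL.const_mul_atTop (by positivity)
  refine tendsto_of_tendsto_of_tendsto_of_le_of_le' tendsto_const_nhds hlim
    (Eventually.of_forall fun _ => zero_le) ?_
  filter_upwards [hL.eventually hbound, hL.eventually_ge_atTop 1, hp1.eventually_gt_atTop 0,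
    hp2.eventually_gt_atTop 0, hT.eventually_gt_atTop 0] with n hn ht hp1 hp2 hT
  have hL0 : 0 < rateL (p1 n) (p2 n) (T n) := Real.sqrt_pos.1 (by linarith)
  have hL4 : √(rateL (p1 n) (p2 n) (T n)) ^ 4 = rateL (p1 n) (p2 n) (T n) ^ 2 := by
    rw [show 4 = 2 * 2 from rfl, pow_mul, Real.sq_sqrt hL0.le]
  rw [hL4] at hn
  set t := √(rateL (p1 n) (p2 n) (T n)) with ht_def
  have ht3 : 1 ≤ t ^ 3 := one_le_pow₀ ht
  set r := fitRate (p1 n) (p2 n) (T n) with hr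
  have hrt : r = (t ^ 3)⁻¹ := rfl
  have hr0 : 0 < r := by rw [hrt]; positivity
  obtain ⟨s, hcard, hsM, hnet⟩ := exists_grid hM (mul_pos hκ0 hr0)
  have hcard' : (s.card : ℝ) ≤ (2 * M / κ + 3) * t ^ 3 := by
    have : 2 * M / (κ * r) = 2 * M / κ * t ^ 3 := by
      rw [hrt]
      field_simp
    rw [this] at hcard
    linarith
  have h1 : 2 * W * (K1 * K2 * (3 * M ^ 2 * (κ * r))) ≤ r / 2 := by
    rw [hq] at hκ1
    nlinarith [mul_le_mul_of_nonneg_right hκ1 hr0.le]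
  have h2 : K1 * K2 * (3 * M ^ 2 * (κ * r)) ≤ b / 16 * r := by
    rw [hq] at hκ2
    nlinarith [mul_le_mul_of_nonneg_right hκ2 hr0.le]
  refine (measure_meanSq_ge_le hp1 hp2 hT hτ (hΘ0 n) (hΘ n) le_rfl hb h1 h2 hsM hnet (μ n) (hX n)
    (hF0 n) (htrue n) (hembed n) (herr n) (hgb n) (hθhat n)).trans (ENNReal.ofReal_le_ofReal ?_)
  refine hn _ _ _ _ _ hT rateL_sq_le.1 rateL_sq_le.2.1 rateL_sq_le.2.2 ?_ hcard'
  have hK1' : (1 : ℝ) ≤ K1 := by exact_mod_cast hK1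
  have hK2' : (1 : ℝ) ≤ K2 := by exact_mod_cast hK2
  push_cast
  have e1 : (p1 n : ℝ) * K1 ≤ K1 * K2 * p1 n := by
    rw [mul_comm, mul_assoc]
    exact mul_le_mul_of_nonneg_left (le_mul_of_one_le_left (by positivity) hK2') (by positivity)
  have e2 : (p2 n : ℝ) * K2 ≤ K1 * K2 * p2 n := by
    rw [mul_comm, mul_assoc]
    exact le_mul_of_one_le_left (by positivity) hK1'
  linarith

end MatrixQuantileFactor

/-! ### Joint consistency of the two estimators -/

open MatrixQuantileFactor in
theorem theorem4p3
    -- quantile level, true and overspecified numbers of factors, constant in the ratios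
    (τ : ℝ) (hτ : τ ∈ Set.Ioo (0 : ℝ) 1)
    (k1 k2 K1 K2 : ℕ) (hk1 : 1 ≤ k1) (hk2 : 1 ≤ k2) (hK1 : k1 < K1) (hK2 : k2 < K2)
    (c0 : ℝ) (hc0 : 0 < c0)
    -- the dimensions tend to infinity jointly, at arbitrary relative rates
    (p1 p2 T : ℕ → ℕ) (hp1 : Tendsto p1 atTop atTop) (hp2 : Tendsto p2 atTop atTop)
    (hT : Tendsto T atTop atTop)
    -- compact sets of the true and of the overspecified parameters
    (A0 : Set (Fin k1 → ℝ)) (S0 : Set (Matrix (Fin k1) (Fin k2) ℝ)) (B0 : Set (Fin k2 → ℝ))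
    (hA0 : IsCompact A0) (hS0 : IsCompact S0) (hB0 : IsCompact B0)
    (A : Set (Fin K1 → ℝ)) (S : Set (Matrix (Fin K1) (Fin K2) ℝ)) (B : Set (Fin K2 → ℝ))
    (hA : IsCompact A) (hS : IsCompact S) (hB : IsCompact B)
    -- data, true loadings and true factors
    (Ω : ℕ → Type*) [∀ n, MeasurableSpace (Ω n)]
    (μ : ∀ n, Measure (Ω n)) [∀ n, IsProbabilityMeasure (μ n)]
    (X : ∀ n, Ω n → Fin (T n) → Matrix (Fin (p1 n)) (Fin (p2 n)) ℝ)
    (hX : ∀ n, Measurable (X n))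
    (R0 : ∀ n, Matrix (Fin (p1 n)) (Fin k1) ℝ) (C0 : ∀ n, Matrix (Fin (p2 n)) (Fin k2) ℝ)
    (F0 : ∀ n, Ω n → Fin (T n) → Matrix (Fin k1) (Fin k2) ℝ)
    (hF0 : ∀ n, Measurable (F0 n))
    -- the true parameter lies in its parameter space, and its common component is attained
    -- in the overspecified parameter space
    (htrue : ∀ n, ∀ᵐ ω ∂(μ n),
      truth (R0 n) (C0 n) (F0 n ω) ∈ paramSpace (p1 n) (p2 n) (T n) A0 S0 B0)
    (hembed : ∀ n, ∀ᵐ ω ∂(μ n), ∃ θ ∈ paramSpace (p1 n) (p2 n) (T n) A S B,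
      ∀ t, θ.common t = (truth (R0 n) (C0 n) (F0 n ω)).common t)
    -- the eigenvalues of the factor second moments converge in probability to positive limits
    (σ : Fin k1 → ℝ) (hσ : ∀ j, 0 < σ j)
    (hσlim : ∀ j, ∀ δ : ℝ, 0 < δ → Tendsto
      (fun n => μ n {ω | δ ≤ |rowGram (F0 n ω) j j - σ j|}) atTop (𝓝 0))
    (σ' : Fin k2 → ℝ) (hσ' : ∀ j, 0 < σ' j)
    (hσlim' : ∀ j, ∀ δ : ℝ, 0 < δ → Tendsto
      (fun n => μ n {ω | δ ≤ |colGram (F0 n ω) j j - σ' j|}) atTop (𝓝 0))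
    -- conditional law of the errors given the factors; the conditional densities are bounded
    -- below on compact sets, uniformly in all indices
    (g : ∀ n, (Fin (T n) → Matrix (Fin k1) (Fin k2) ℝ) →
      Fin (p1 n) × Fin (p2 n) × Fin (T n) → ℝ → ℝ)
    (herr : ∀ n, ErrorLaw (μ n) τ
      (fun ω => errors (X n ω) (truth (R0 n) (C0 n) (F0 n ω))) (F0 n) (g n))
    (hg : ∀ D : Set ℝ, IsCompact D → ∃ b : ℝ, 0 < b ∧
      ∀ n, ∀ᵐ f ∂((μ n).map (F0 n)), ∀ a, ∀ u ∈ D, b ≤ g n f a u)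
    -- the overspecified fit and the eigenvalue-ratio estimators computed from it
    (θhat : ∀ n, Ω n → Param (p1 n) (p2 n) (T n) K1 K2)
    (hθhat : ∀ n, ∀ᵐ ω ∂(μ n),
      IsQuantileFit τ (X n ω) (paramSpace (p1 n) (p2 n) (T n) A S B) (θhat n ω))
    (k1hat k2hat : ∀ n, Ω n → ℕ)
    (hk1meas : ∀ n, Measurable (k1hat n)) (hk2meas : ∀ n, Measurable (k2hat n))
    (hk1hat : ∀ n, ∀ᵐ ω ∂(μ n),
      IsERChoice (rowGram (θhat n ω).F) c0 (rateL (p1 n) (p2 n) (T n)) (k1hat n ω))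
    (hk2hat : ∀ n, ∀ᵐ ω ∂(μ n),
      IsERChoice (colGram (θhat n ω).F) c0 (rateL (p1 n) (p2 n) (T n)) (k2hat n ω)) :
    Tendsto (fun n => μ n {ω | k1hat n ω = k1 ∧ k2hat n ω = k2}) atTop (𝓝 1) := by

  obtain ⟨M0, hM0, hΘ0⟩ := exists_entries_bound hA0 hS0 hB0
  obtain ⟨M, hM, hΘ⟩ := exists_entries_bound hA hS hB
  have hL : Tendsto (fun n => √(rateL (p1 n) (p2 n) (T n))) atTop atTop :=
    Real.tendsto_sqrt_atTop.comp (tendsto_rateL hp1 hp2 hT)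
  have hfit := tendsto_measure_fitRate_le_meanSq hτ (by omega) (by omega) hp1 hp2 hT hL hM hM0
    (fun n => hΘ0 (p1 n) (p2 n) (T n)) (fun n => hΘ (p1 n) (p2 n) (T n)) μ hX hF0 htrue hembed
    herr hg hθhat
  have h0 : ∀ n, ∀ᵐ ω ∂(μ n), (truth (R0 n) (C0 n) (F0 n ω)).IsNormalized := fun n => by
    filter_upwards [htrue n] with ω h
    exact h.2.2.2
  have hhat : ∀ n, ∀ᵐ ω ∂(μ n), (θhat n ω).IsNormalized := fun n => by
    filter_upwards [hθhat n] with ω h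
    exact h.1.2.2.2
  have hFM : ∀ n, ∀ᵐ ω ∂(μ n), ∀ t a b, |(θhat n ω).F t a b| ≤ M := fun n => by
    filter_upwards [hθhat n] with ω h t a b
    exact hΘ _ _ _ _ h.1 (Sum.inr (Sum.inl (t, a, b)))
  have hrow := tendsto_measure_ne_of_isERChoice hk1 hK1 hc0 hp1 hp2 hT hL μ h0 hhat hFM
    (hσ ⟨k1 - 1, by omega⟩) (hσlim _ _ (half_pos (hσ _))) hfit hk1hat
  have hrate : ∀ n, rateL (p2 n) (p1 n) (T n) = rateL (p1 n) (p2 n) (T n) := fun n => by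
    unfold rateL
    rw [mul_comm (p2 n : ℝ) (p1 n), min_comm (√((p2 n : ℝ) * T n))]
  -- Transposition exchanges the two Gram matrices and leaves both L and `meanSq` unchanged, so the
  -- rate already obtained is reused.
  have hcol := tendsto_measure_ne_of_isERChoice hk2 hK2 hc0 hp2 hp1 hT
    (by simpa only [hrate] using hL) μ
    (θ0 := fun n ω => (truth (R0 n) (C0 n) (F0 n ω)).transpose)
    (θhat := fun n ω => (θhat n ω).transpose)
    (fun n => (h0 n).mono fun _ h => h.transpose) (fun n => (hhat n).mono fun _ h => h.transpose)
    (fun n => (hFM n).mono fun _ h t a b => h t b a) (hσ' ⟨k2 - 1, by omega⟩)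
    (by
      simp only [Param.rowGram_transpose]
      exact hσlim' _ _ (half_pos (hσ' _)))
    (by simpa only [fitRate, hrate, meanSq_transpose] using hfit)
    (by simpa only [hrate, Param.rowGram_transpose] using hk2hat)
  have hmeas : ∀ n, MeasurableSet {ω | k1hat n ω = k1 ∧ k2hat n ω = k2} := fun n =>
    (hk1meas n (measurableSet_singleton k1)).inter (hk2meas n (measurableSet_singleton k2))
  have hcompl : Tendsto (fun n => μ n {ω | k1hat n ω = k1 ∧ k2hat n ω = k2}ᶜ) atTop (𝓝 0) := by
    have hsum := hrow.add hcol
    rw [add_zero] at hsum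
    refine tendsto_of_tendsto_of_tendsto_of_le_of_le tendsto_const_nhds hsum
      (fun _ => zero_le) fun n => ?_
    refine (measure_mono fun ω hω => ?_).trans (measure_union_le _ _)
    by_contra h
    exact hω ⟨not_not.1 fun h' => h (Or.inl h'), not_not.1 fun h' => h (Or.inr h')⟩
  have heq : ∀ n, μ n {ω | k1hat n ω = k1 ∧ k2hat n ω = k2}
      = 1 - μ n {ω | k1hat n ω = k1 ∧ k2hat n ω = k2}ᶜ := fun n => by
    rw [← prob_compl_eq_one_sub (hmeas n).compl, compl_compl]
  simp_rw [heq]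
  simpa using ENNReal.Tendsto.sub tendsto_const_nhds hcompl (Or.inl ENNReal.one_ne_top)
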